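/- Let $D>0$ be an integer that is not a square, with $D\equiv 0,1 \pmod 4$, and let $\mathfrak{o}_D=\mathbb{Z}\big[\tfrac{D+\sqrt D}{2}\big]$ be the order of discriminant $D$ in the real quadratic field $\mathbb{Q}(\sqrt D)$. A $(1,2)$-polarized abelian surface $(A,\mathcal{L})$ is a complex torus $A=\mathbb{C}^2/\Lambda$ with a polarization $\mathcal{L}$ of type $(1,2)$, i.e. the imaginary part $E$ of a positive definite Hermitian form on $\mathbb{C}^2$ that has the matrix $\begin{pmatrix}0&P\\-P&0\end{pmatrix}$, $P=\mathrm{diag}(1,2)$, in some $\mathbb{Z}$-basis of $\Lambda$. It has real multiplication by $\mathfrak{o}_D$ if there is an injective ring homomorphism $\rho:\mathfrak{o}_D\to\mathrm{End}(A)$ whose image consists of endomorphisms that are self-adjoint with respect to $E$ and which is proper, i.e. does not extend to a larger order of $\mathbb{Q}(\sqrt D)$. The isomorphism classes of $(1,2)$-polarized abelian surfaces form the moduli space $\mathcal{A}_{(1,2)}$, the quotient of the Siegel upper half space $\mathbb{H}_2$ (of complex symmetric $2\times2$ matrices with positive definite imaginary part) by the map sending $Z$ to the class of $\mathbb{C}^2/(Z\mathbb{Z}^2+P\mathbb{Z}^2)$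 with the Hermitian form $H(x,y)=x^T(\mathrm{Im} Z)^{-1}\bar y$. A subset of $\mathcal{A}_{(1,2)}$ is called analytic if its preimage in $\mathbb{H}_2$ is a closed analytic subset, and a non-empty analytic subset is called irreducible if, whenever it is contained in the union of two analytic subsets of $\mathcal{A}_{(1,2)}$, it is contained in one of them. Let $X_{D,(1,2)}\subset\mathcal{A}_{(1,2)}$ be the locus of the $(1,2)$-polarized abelian surfaces that have real multiplication by $\mathfrak{o}_D$. Then: (i) if $D\equiv 5 \pmod 8$, then $X_{D,(1,2)}$ is empty; (ii) if $D\equiv 0$ or $4 \pmod 8$, then $X_{D,(1,2)}$ is non-empty and is an irreducible analytic subset of $\mathcal{A}_{(1,2)}$; (iii) if $D\equiv 1 \pmod 8$, then $X_{D,(1,2)}$ is non-empty and is an irreducible analytic subset of $\mathcal{A}_{(1,2)}$. -/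

import Mathlib

open scoped Matrix

/-! ### Quadratic orders -/

/-- The quadratic order `𝔬_D = ℤ[(D + √D) / 2]` of discriminant `D` (for `D ≡ 0, 1 mod 4`),
presented as `ℤ[ω]` with `ω ^ 2 = (D - D ^ 2) / 4 + D * ω`; the integer division is exact for
these `D`, and the discriminant of the minimal polynomial of `ω` is `D`. -/
abbrev QuadraticOrder (D : ℤ) : Type := QuadraticAlgebra ℤ ((D - D ^ 2) / 4) D

/-! ### `(1,2)`-polarized abelian surfaces -/

/-- The type `(1,2)` of the polarization. -/
def polType : Fin 2 → ℤ := ![1, 2]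

/-- A `(1,2)`-polarized complex abelian surface `ℂ² / Λ`: a lattice `Λ ⊂ ℂ²` together with a
polarization, given by its Riemann form `E`, the imaginary part of the positive definite Hermitian
form `H(x, y) = E(i x, y) + i E(x, y)`. -/
structure PolarizedAbelianSurface where
  /-- The period lattice. -/
  lattice : Submodule ℤ (Fin 2 → ℂ)
  discrete : DiscreteTopology lattice
  span_eq_top : Submodule.span ℝ (lattice : Set (Fin 2 → ℂ)) = ⊤
  /-- The Riemann form. -/
  form : (Fin 2 → ℂ) →ₗ[ℝ] (Fin 2 → ℂ) →ₗ[ℝ] ℝ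
  form_self : ∀ x, form x x = 0
  form_I_smul : ∀ x y, form (Complex.I • x) (Complex.I • y) = form x y
  form_pos : ∀ x, x ≠ 0 → 0 < form (Complex.I • x) x
  /-- The form is integral of type `(1,2)` on the lattice: there is a `ℤ`-basis of the lattice in
  which its matrix is `[[0, P], [-P, 0]]` with `P = diag (1, 2)`. -/
  exists_symplectic_basis : ∃ b : Module.Basis (Fin 2 ⊕ Fin 2) ℤ lattice,
    (∀ i j, form (b (.inl i)) (b (.inl j)) = 0) ∧
    (∀ i j, form (b (.inr i)) (b (.inr j)) = 0) ∧
    (∀ i j, form (b (.inl i)) (b (.inr j)) = if i = j then (polType i : ℝ) else 0)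

namespace PolarizedAbelianSurface

/-- Isomorphism of polarized abelian surfaces. -/
def Iso (A B : PolarizedAbelianSurface) : Prop :=
  ∃ φ : (Fin 2 → ℂ) ≃ₗ[ℂ] (Fin 2 → ℂ),
    (∀ x, φ x ∈ B.lattice ↔ x ∈ A.lattice) ∧ ∀ x y, B.form (φ x) (φ y) = A.form x y

instance isoSetoid : Setoid PolarizedAbelianSurface where
  r := Iso
  iseqv :=
    { refl := fun _ => ⟨LinearEquiv.refl ℂ _, fun _ => Iff.rfl, fun _ _ => rfl⟩
      symm := by
        rintro A B ⟨φ, h₁, h₂⟩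
        exact ⟨φ.symm, fun x => by rw [← h₁, φ.apply_symm_apply],
          fun x y => by rw [← h₂, φ.apply_symm_apply, φ.apply_symm_apply]⟩
      trans := by
        rintro A B C ⟨φ, h₁, h₂⟩ ⟨ψ, k₁, k₂⟩
        exact ⟨φ.trans ψ, fun x => by rw [LinearEquiv.trans_apply, k₁, h₁],
          fun x y => by rw [LinearEquiv.trans_apply, LinearEquiv.trans_apply, k₂, h₂]⟩ }

/-- The endomorphism ring of the complex torus `ℂ² / Λ`: the `ℂ`-linear maps preserving `Λ`. -/
def endRing (A : PolarizedAbelianSurface) : Subring (Module.End ℂ (Fin 2 → ℂ)) where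
  carrier := {T | ∀ x ∈ A.lattice, T x ∈ A.lattice}
  mul_mem' := fun {_ _} hS hT x hx => hS _ (hT x hx)
  one_mem' := fun _ hx => hx
  add_mem' := fun {_ _} hS hT x hx => A.lattice.add_mem (hS x hx) (hT x hx)
  zero_mem' := fun _ _ => A.lattice.zero_mem
  neg_mem' := fun {_} hT x hx => A.lattice.neg_mem (hT x hx)

/-- `A` has real multiplication by `𝔬_D`: there is an embedding `ρ` of `𝔬_D` into the endomorphism
ring by endomorphisms that are self-adjoint for the polarization, and this embedding is proper, that
is, it does not extend to a larger order of `ℚ(√D)`: every endomorphism in `ρ(𝔬_D) ⊗ ℚ` lies in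
`ρ(𝔬_D)`. -/
def HasRealMultiplication (A : PolarizedAbelianSurface) (D : ℤ) : Prop :=
  ∃ ρ : QuadraticOrder D →+* A.endRing,
    Function.Injective ρ ∧
    (∀ a x y, A.form ((ρ a : Module.End ℂ (Fin 2 → ℂ)) x) y =
      A.form x ((ρ a : Module.End ℂ (Fin 2 → ℂ)) y)) ∧
    ∀ (T : A.endRing) (n : ℤ) (a : QuadraticOrder D), n ≠ 0 → n • T = ρ a → ∃ c, ρ c = T

end PolarizedAbelianSurface

/-- The moduli space of `(1,2)`-polarized abelian surfaces (as a set: isomorphism classes). Its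
analytic structure is that of the quotient of the Siegel upper half space by the period map
`periodMap` below. -/
abbrev ModuliSpace : Type := Quotient PolarizedAbelianSurface.isoSetoid

/-- The locus `X_{D,(1,2)}` of `(1,2)`-polarized abelian surfaces with real multiplication by
`𝔬_D`, in the moduli space of `(1,2)`-polarized abelian surfaces. -/
def realMultiplicationLocus (D : ℤ) : Set ModuliSpace :=
  {m | ∃ A : PolarizedAbelianSurface, Quotient.mk _ A = m ∧ A.HasRealMultiplication D}

/-! ### Siegel upper half space and the period map -/

/-- The symmetric complex `2 × 2` matrix with entries `τ₀, τ₁, τ₂`. -/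
def symMatrix (τ : Fin 3 → ℂ) : Matrix (Fin 2) (Fin 2) ℂ := !![τ 0, τ 1; τ 1, τ 2]

/-- The imaginary part of `symMatrix τ`. -/
def imMatrix (τ : Fin 3 → ℂ) : Matrix (Fin 2) (Fin 2) ℝ := (symMatrix τ).map Complex.im

/-- The Siegel upper half space of degree two, in the coordinates `τ₀, τ₁, τ₂`. -/
def siegelSpace : Set (Fin 3 → ℂ) := {τ | (imMatrix τ).PosDef}

/-- The columns of the period matrix `(Z, P)`, with `Z = symMatrix τ` and `P = diag (1, 2)`. -/
def periodVector (τ : Fin 3 → ℂ) : Fin 2 ⊕ Fin 2 → (Fin 2 → ℂ)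
  | .inl i => fun k => symMatrix τ k i
  | .inr i => fun k => if k = i then (polType i : ℂ) else 0

/-- The real part of a complex vector. -/
def reVec : (Fin 2 → ℂ) →ₗ[ℝ] (Fin 2 → ℝ) := Complex.reLm.compLeft (Fin 2)

/-- The imaginary part of a complex vector. -/
def imVec : (Fin 2 → ℂ) →ₗ[ℝ] (Fin 2 → ℝ) := Complex.imLm.compLeft (Fin 2)

/-- The Riemann form `E(x, y) = Im (xᵀ (Im Z)⁻¹ ȳ)` of the period matrix `(Z, P)`. -/
noncomputable def periodForm (τ : Fin 3 → ℂ) : (Fin 2 → ℂ) →ₗ[ℝ] (Fin 2 → ℂ) →ₗ[ℝ] ℝ :=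
  (Matrix.toLinearMap₂' ℝ (imMatrix τ)⁻¹).compl₁₂ imVec reVec -
    (Matrix.toLinearMap₂' ℝ (imMatrix τ)⁻¹).compl₁₂ reVec imVec

theorem periodForm_apply (τ : Fin 3 → ℂ) (x y : Fin 2 → ℂ) :
    periodForm τ x y = imVec x ⬝ᵥ ((imMatrix τ)⁻¹ *ᵥ reVec y) -
      reVec x ⬝ᵥ ((imMatrix τ)⁻¹ *ᵥ imVec y) := by
  simp only [periodForm, LinearMap.sub_apply, LinearMap.compl₁₂_apply, Matrix.toLinearMap₂'_apply']

theorem imMatrix_transpose (τ : Fin 3 → ℂ) : (imMatrix τ)ᵀ = imMatrix τ := by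
  ext i j
  fin_cases i <;> fin_cases j <;> rfl

theorem dotProduct_inv_imMatrix_comm (τ : Fin 3 → ℂ) (v w : Fin 2 → ℝ) :
    v ⬝ᵥ ((imMatrix τ)⁻¹ *ᵥ w) = w ⬝ᵥ ((imMatrix τ)⁻¹ *ᵥ v) := by
  rw [Matrix.dotProduct_mulVec, ← Matrix.mulVec_transpose, Matrix.transpose_nonsing_inv,
    imMatrix_transpose, dotProduct_comm]

theorem reVec_I_smul (x : Fin 2 → ℂ) : reVec (Complex.I • x) = -imVec x := by
  ext i
  simp [reVec, imVec]

theorem imVec_I_smul (x : Fin 2 → ℂ) : imVec (Complex.I • x) = reVec x := by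
  ext i
  simp [reVec, imVec]

theorem periodForm_self (τ : Fin 3 → ℂ) (x : Fin 2 → ℂ) : periodForm τ x x = 0 := by
  rw [periodForm_apply, dotProduct_inv_imMatrix_comm, sub_self]

theorem periodForm_I_smul (τ : Fin 3 → ℂ) (x y : Fin 2 → ℂ) :
    periodForm τ (Complex.I • x) (Complex.I • y) = periodForm τ x y := by
  simp only [periodForm_apply, reVec_I_smul, imVec_I_smul, Matrix.mulVec_neg, dotProduct_neg,
    neg_dotProduct]
  ring

theorem periodForm_pos {τ : Fin 3 → ℂ} (hτ : τ ∈ siegelSpace) (x : Fin 2 → ℂ) (hx : x ≠ 0) :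
    0 < periodForm τ (Complex.I • x) x := by
  have hM : (imMatrix τ)⁻¹.PosDef := Matrix.PosDef.inv hτ
  have hnn : ∀ v : Fin 2 → ℝ, 0 ≤ v ⬝ᵥ ((imMatrix τ)⁻¹ *ᵥ v) := fun v => by
    rcases eq_or_ne v 0 with rfl | hv
    · simp
    · simpa using (hM.dotProduct_mulVec_pos hv).le
  rw [periodForm_apply, reVec_I_smul, imVec_I_smul, neg_dotProduct, sub_neg_eq_add]
  by_cases hr : reVec x = 0
  · have hi : imVec x ≠ 0 := by
      intro hi
      apply hx
      ext i
      exact Complex.ext (congrFun hr i) (congrFun hi i)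
    have h := hM.dotProduct_mulVec_pos hi
    have h0 := hnn (reVec x)
    simp only [star_trivial] at h
    linarith
  · have h := hM.dotProduct_mulVec_pos hr
    have h0 := hnn (imVec x)
    simp only [star_trivial] at h
    linarith

theorem inv_imMatrix_mulVec_imVec {τ : Fin 3 → ℂ} (hτ : τ ∈ siegelSpace) (i : Fin 2) :
    (imMatrix τ)⁻¹ *ᵥ imVec (periodVector τ (.inl i)) = Pi.single i 1 := by
  have h : imVec (periodVector τ (.inl i)) = imMatrix τ *ᵥ Pi.single i 1 := by
    rw [Matrix.mulVec_single_one]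
    rfl
  have hu : IsUnit (imMatrix τ).det := (Matrix.isUnit_iff_isUnit_det _).1 (Matrix.PosDef.isUnit hτ)
  rw [h, Matrix.mulVec_mulVec, Matrix.nonsing_inv_mul _ hu, Matrix.one_mulVec]

theorem imVec_periodVector_inr (τ : Fin 3 → ℂ) (i : Fin 2) :
    imVec (periodVector τ (.inr i)) = 0 := by
  ext k
  by_cases h : k = i <;> simp [imVec, periodVector, h]

theorem reVec_periodVector_inr (τ : Fin 3 → ℂ) (i j : Fin 2) :
    reVec (periodVector τ (.inr i)) j = if j = i then (polType i : ℝ) else 0 := by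
  by_cases h : j = i <;> simp [reVec, periodVector, h]

theorem periodForm_inl_inl {τ : Fin 3 → ℂ} (hτ : τ ∈ siegelSpace) (i j : Fin 2) :
    periodForm τ (periodVector τ (.inl i)) (periodVector τ (.inl j)) = 0 := by
  rw [periodForm_apply, dotProduct_inv_imMatrix_comm, inv_imMatrix_mulVec_imVec hτ,
    inv_imMatrix_mulVec_imVec hτ, dotProduct_single_one, dotProduct_single_one]
  fin_cases i <;> fin_cases j <;> simp [reVec, periodVector, symMatrix]

theorem periodForm_inr_inr (τ : Fin 3 → ℂ) (i j : Fin 2) :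
    periodForm τ (periodVector τ (.inr i)) (periodVector τ (.inr j)) = 0 := by
  simp [periodForm_apply, imVec_periodVector_inr]

theorem periodForm_inl_inr {τ : Fin 3 → ℂ} (hτ : τ ∈ siegelSpace) (i j : Fin 2) :
    periodForm τ (periodVector τ (.inl i)) (periodVector τ (.inr j)) =
      if i = j then (polType i : ℝ) else 0 := by
  rw [periodForm_apply, dotProduct_inv_imMatrix_comm, inv_imMatrix_mulVec_imVec hτ,
    imVec_periodVector_inr, dotProduct_single_one, reVec_periodVector_inr]
  by_cases h : i = j <;> simp [h]

theorem polType_ne_zero (i : Fin 2) : polType i ≠ 0 := by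
  fin_cases i <;> simp [polType]

theorem linearIndependent_periodVector {τ : Fin 3 → ℂ} (hτ : τ ∈ siegelSpace) :
    LinearIndependent ℝ (periodVector τ) := by
  rw [Fintype.linearIndependent_iff]
  intro g hg
  rw [Fintype.sum_sum_type] at hg
  rintro (i | i)
  · have h := congrArg (fun v => periodForm τ v (periodVector τ (.inr i))) hg
    fin_cases i <;> simpa [periodForm_inl_inr hτ, periodForm_inr_inr, polType_ne_zero] using h
  · have h := congrArg (fun v => periodForm τ (periodVector τ (.inl i)) v) hg
    fin_cases i <;> simpa [periodForm_inl_inr hτ, periodForm_inl_inl hτ, polType_ne_zero] using h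

/-- The columns of the period matrix form a real basis of `ℂ²`. -/
noncomputable def periodBasis {τ : Fin 3 → ℂ} (hτ : τ ∈ siegelSpace) :
    Module.Basis (Fin 2 ⊕ Fin 2) ℝ (Fin 2 → ℂ) :=
  basisOfLinearIndependentOfCardEqFinrank (linearIndependent_periodVector hτ)
    (by simp [Module.finrank_pi_fintype, Complex.finrank_real_complex])

theorem coe_periodBasis {τ : Fin 3 → ℂ} (hτ : τ ∈ siegelSpace) :
    ⇑(periodBasis hτ) = periodVector τ :=
  coe_basisOfLinearIndependentOfCardEqFinrank _ _

/-- The `(1,2)`-polarized abelian surface with period matrix `(Z, P)`, `Z = symMatrix τ`. -/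
noncomputable def periodSurface (τ : siegelSpace) : PolarizedAbelianSurface where
  lattice := Submodule.span ℤ (Set.range (periodBasis τ.2))
  discrete := inferInstance
  span_eq_top := IsZLattice.span_top
  form := periodForm τ
  form_self := periodForm_self τ
  form_I_smul := periodForm_I_smul τ
  form_pos := periodForm_pos τ.2
  exists_symplectic_basis := by
    refine ⟨(periodBasis τ.2).restrictScalars ℤ, ?_, ?_, ?_⟩ <;> intro i j <;>
      simp only [Module.Basis.restrictScalars_apply, coe_periodBasis]
    · exact periodForm_inl_inl τ.2 i j
    · exact periodForm_inr_inr τ i j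
    · exact periodForm_inl_inr τ.2 i j

/-- The period map from the Siegel upper half space to the moduli space. -/
noncomputable def periodMap (τ : siegelSpace) : ModuliSpace := Quotient.mk _ (periodSurface τ)

/-! ### Analytic subsets and irreducibility -/

/-- `S` is a (closed) analytic subset of the open set `Ω ⊆ ℂ³`: locally on `Ω` it is the common
zero set of finitely many holomorphic functions. -/
def IsAnalyticSubset (Ω S : Set (Fin 3 → ℂ)) : Prop :=
  S ⊆ Ω ∧ ∀ z ∈ Ω, ∃ U : Set (Fin 3 → ℂ), IsOpen U ∧ z ∈ U ∧ U ⊆ Ω ∧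
    ∃ (n : ℕ) (f : Fin n → (Fin 3 → ℂ) → ℂ), (∀ i, AnalyticOnNhd ℂ (f i) U) ∧
      S ∩ U = {w ∈ U | ∀ i, f i w = 0}

/-- A subset of the moduli space is a (closed) analytic subset if its preimage under the period map
is an analytic subset of the Siegel upper half space. (The moduli space is the quotient of the
Siegel space by a properly discontinuous group, whose orbits are the fibres of the period map, so
its analytic subsets correspond to the invariant analytic subsets of the Siegel space.) -/
def IsAnalyticInModuli (S : Set ModuliSpace) : Prop :=
  IsAnalyticSubset siegelSpace (Subtype.val '' (periodMap ⁻¹' S))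

/-- `S` is an irreducible analytic subset of the moduli space: a non-empty analytic subset that is
not covered by two analytic subsets unless one of them contains it. -/
def IsIrreducibleInModuli (S : Set ModuliSpace) : Prop :=
  S.Nonempty ∧ IsAnalyticInModuli S ∧
    ∀ A B : Set ModuliSpace, IsAnalyticInModuli A → IsAnalyticInModuli B → S ⊆ A ∪ B →
      S ⊆ A ∨ S ⊆ B

set_option linter.unusedSimpArgs false

/-! ### Integral vectors of singular relations -/

/-! In a symplectic basis of type (1,2), a self-adjoint endomorphism is, up to an added integer, a
map T given by five integers v = (k, a, b, c, d). It satisfies T² = kT + 2(ab − cd), so ℤ[T] has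
discriminant k² + 8(ab − cd), and the embedding is proper exactly when v is primitive. For the
columns of (Z, P), the coefficients v come from a ℂ-linear map exactly when Z satisfies one
equation, Humbert's singular relation. The preimage of the locus is thus the union of these
hypersurfaces over the primitive v of discriminant D (`mem_realMultiplicationLocus_iff`).

As `disc v` ≡ k² mod 8, D ≡ 5 is impossible. Changes of symplectic basis act on v, and for nonsquare
D they bring every primitive v, up to sign, to (k, 0, 0, 1, d) with k ∈ {0, 1, 2}
(`Stable.exists_normal_form`); D mod 8 determines k, and then D determines d. Every symplectic basis
becomes the columns of some (Z, P) after a ℂ-linear change of coordinates (`exists_period`), so the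
locus is the image of the single slice τ₂ = −2dτ₀ − kτ₁ of the Siegel space. The slice is convex,
and nonempty because D > 0; the identity theorem on it gives irreducibility.

Analyticity is local finiteness: the real vectors satisfying the relation at τ form a space on which
the discriminant form is positive definite, so only finitely many v of discriminant D matter near a
point (`boundedBy_of_singularForm_eq_zero`). -/

/-- The coefficients of a singular relation. -/
structure SingularVector where
  k : ℤ
  a : ℤ
  b : ℤ
  c : ℤ
  d : ℤ

namespace SingularVector

/-- The discriminant of a singular relation. -/
def disc (v : SingularVector) : ℤ := v.k ^ 2 + 8 * (v.a * v.b - v.c * v.d)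

/-- The coefficients have no common prime divisor. -/
def IsPrimitive (v : SingularVector) : Prop :=
  ∀ p : ℤ, Prime p → p ∣ v.k → p ∣ v.a → p ∣ v.b → p ∣ v.c → p ∣ v.d → False

/-- The action of a unimodular matrix on the first hyperbolic pair. -/
def actLeft (v : SingularVector) (p q r s : ℤ) : SingularVector :=
  ⟨v.k, p * v.a + q * v.d, r * v.c + s * v.b, p * v.c + q * v.b, r * v.a + s * v.d⟩

/-- The action of a unimodular matrix on the second hyperbolic pair. -/
def actRight (v : SingularVector) (p q r s : ℤ) : SingularVector :=
  ⟨v.k, p * v.a + q * v.c, r * v.d + s * v.b, r * v.a + s * v.c, p * v.d + q * v.b⟩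

/-- The action of the transvections mixing the two hyperbolic pairs. -/
def actShear (v : SingularVector) (m : ℤ) : SingularVector :=
  ⟨v.k - 4 * m * v.c, v.a, v.b, v.c, v.d - m * v.k + 2 * m ^ 2 * v.c⟩

/-- The opposite vector. -/
def actNeg (v : SingularVector) : SingularVector := ⟨-v.k, -v.a, -v.b, -v.c, -v.d⟩

/-- A set of vectors that is stable under the changes of symplectic frames. -/
structure Stable (P : SingularVector → Prop) : Prop where
  left : ∀ v p q r s, p * s - q * r = 1 → P v → P (v.actLeft p q r s)
  right : ∀ v p q r s, p * s - q * r = 1 → P v → P (v.actRight p q r s)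
  shear : ∀ v m, P v → P (v.actShear m)
  neg : ∀ v, P v → P v.actNeg

end SingularVector

/-! ### Arithmetic of integral vectors and the normal form -/

theorem exists_isCoprime_add_mul (a b d : ℤ) (ha : a ≠ 0)
    (h : ∀ p : ℤ, Prime p → p ∣ a → p ∣ b → p ∣ d → False) : ∃ m : ℤ, IsCoprime a (d + m * b) := by
  classical
  set s := a.natAbs.primeFactors.filter (fun p : ℕ => ¬ (p : ℤ) ∣ d) with hs
  -- Take for m the product of the primes dividing a but not d. A prime q ∣ a with q ∣ d divides
  -- neither b nor m; one with q ∤ d divides m. Either way q ∤ d + mb.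
  refine ⟨∏ p ∈ s, (p : ℤ), ?_⟩
  refine isCoprime_of_prime_dvd (fun h0 => ha h0.1) ?_
  intro q hq hqa hqd
  have hq' : (q.natAbs).Prime := Int.prime_iff_natAbs_prime.1 hq
  have key : ∀ x : ℤ, q ∣ x ↔ (q.natAbs : ℤ) ∣ x := fun x => Int.natAbs_dvd.symm
  by_cases hd : q ∣ d
  · have h1 : q ∣ (∏ p ∈ s, (p : ℤ)) * b := (dvd_add_right hd).1 hqd
    rcases hq.dvd_or_dvd h1 with h2 | h2
    · obtain ⟨p, hp, hqp⟩ := (Prime.dvd_finsetProd_iff hq _).1 h2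
      rw [hs, Finset.mem_filter] at hp
      have hpp : p.Prime := Nat.prime_of_mem_primeFactors hp.1
      have : q.natAbs = p := (Nat.prime_dvd_prime_iff_eq hq' hpp).1 (by
        rw [key] at hqp; exact_mod_cast hqp)
      exact hp.2 (by rw [← this, ← key]; exact hd)
    · exact h q hq hqa h2 hd
  · have h1 : q ∣ (∏ p ∈ s, (p : ℤ)) := by
      rw [key]
      apply Finset.dvd_prod_of_mem (fun p : ℕ => (p : ℤ))
      rw [hs, Finset.mem_filter]
      refine ⟨Nat.mem_primeFactors.2 ⟨hq', Int.natAbs_dvd_natAbs.2 hqa, by simpa using ha⟩, ?_⟩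
      rwa [← key]
    exact hd ((dvd_add_left (h1.mul_right b)).1 hqd)

/-- Away from zero, the rows are (y/g, −x/g) and the Bézout coefficients, where g is the gcd. -/
theorem exists_unimodular_mul_eq (x y : ℤ) : ∃ p q r s g : ℤ, p * s - q * r = 1 ∧
    p * x + q * y = 0 ∧ r * x + s * y = g := by
  by_cases hx : x = 0 ∧ y = 0
  · exact ⟨1, 0, 0, 1, 0, by norm_num, by simp [hx.1], by simp [hx.2]⟩
  · have hg : (Int.gcd x y : ℤ) ≠ 0 := by
      simpa [Int.gcd_eq_zero_iff] using hx
    obtain ⟨x', hx'⟩ := Int.gcd_dvd_left x y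
    obtain ⟨y', hy'⟩ := Int.gcd_dvd_right x y
    have hb := Int.gcd_eq_gcd_ab x y
    set g : ℤ := (Int.gcd x y : ℤ) with hgdef
    refine ⟨y', -x', x.gcdA y, x.gcdB y, g, ?_, ?_, ?_⟩
    · apply mul_left_cancel₀ hg
      linear_combination -hb - x.gcdA y * hx' - x.gcdB y * hy'
    · linear_combination y' * hx' - x' * hy'
    · linear_combination -hb

namespace SingularVector

/-- View (a, b, c, d) as the matrix with rows (a, c) and (d, b), of determinant ab − cd: the left
and right moves are row and column operations of determinant 1. These alone cannot use k to make the
entries coprime; the shear can. -/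
theorem Stable.exists_normal_form {P : SingularVector → Prop} (hP : Stable P) {v : SingularVector}
    (hv : P v) (hprim : v.IsPrimitive) (hsq : ¬ IsSquare v.disc) :
    ∃ k d : ℤ, (k = 0 ∨ k = 1 ∨ k = 2) ∧ k ^ 2 - 8 * d = v.disc ∧ P ⟨k, 0, 0, 1, d⟩ := by
  -- make `c` vanish
  obtain ⟨w, hw, hwp, hwd, hwc⟩ : ∃ w, P w ∧ w.IsPrimitive ∧ w.disc = v.disc ∧ w.c = 0 := by
    obtain ⟨p, q, r, s, g, h1, h2, -⟩ := exists_unimodular_mul_eq v.c v.b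
    refine ⟨v.actLeft p q r s, hP.left v p q r s h1 hv, ?_, ?_, h2⟩
    · intro t ht hk ha hb hc hd
      simp only [actLeft] at hk ha hb hc hd
      refine hprim t ht hk ?_ ?_ ?_ ?_
      · have := dvd_sub (ha.mul_left s) (hd.mul_left q)
        rwa [show s * (p * v.a + q * v.d) - q * (r * v.a + s * v.d) = v.a by
          linear_combination v.a * h1] at this
      · have := dvd_sub (hb.mul_left p) (hc.mul_left r)
        rwa [show p * (r * v.c + s * v.b) - r * (p * v.c + q * v.b) = v.b by
          linear_combination v.b * h1] at this
      · have := dvd_sub (hc.mul_left s) (hb.mul_left q)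
        rwa [show s * (p * v.c + q * v.b) - q * (r * v.c + s * v.b) = v.c by
          linear_combination v.c * h1] at this
      · have := dvd_sub (hd.mul_left p) (ha.mul_left r)
        rwa [show p * (r * v.a + s * v.d) - r * (p * v.a + q * v.d) = v.d by
          linear_combination v.d * h1] at this
    · simp only [disc, actLeft]
      linear_combination 8 * (v.a * v.b - v.c * v.d) * h1
  obtain ⟨k, a, b, c, d⟩ := w
  simp only at hwc
  subst hwc
  rw [← hwd] at hsq ⊢
  clear hwd hv hprim
  -- With c = 0 the discriminant is k² + 8ab; this is where D being nonsquare is needed.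
  have hab : a * b ≠ 0 := by
    intro h
    apply hsq
    refine ⟨k, ?_⟩
    simp only [disc]
    linear_combination 8 * h
  have ha : a ≠ 0 := left_ne_zero_of_mul hab
  -- make the entries of the matrix part coprime
  obtain ⟨m, hm⟩ := exists_isCoprime_add_mul (Int.gcd a b) k d
    (by simpa [Int.gcd_eq_zero_iff] using fun h => absurd h ha) (fun p hp h1 h2 h3 =>
      hwp p hp h2 (h1.trans (Int.gcd_dvd_left a b)) (h1.trans (Int.gcd_dvd_right a b))
        (dvd_zero p) h3)
  -- As c = 0, the shear keeps k and only adds mk to d.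
  have h1 := hP.shear _ (-m) hw
  simp only [actShear, mul_zero, sub_zero, add_zero, neg_mul, sub_neg_eq_add] at h1
  obtain ⟨n, hn⟩ := exists_isCoprime_add_mul a b (d + m * k) ha (fun p hp h1 h2 h3 =>
    hp.not_isUnit (hm.isUnit_of_dvd' (Int.dvd_coe_gcd h1 h2) h3))
  have h2 := hP.right _ 1 n 0 1 (by norm_num) h1
  simp only [actRight, mul_zero, zero_mul, one_mul, add_zero, zero_add] at h2
  set d' := d + m * k + n * b with hd'
  obtain ⟨x, y, hxy⟩ := hn
  -- make the first column equal to `(1, 0)`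
  have h3 := hP.left _ x y (-d') a (by linear_combination hxy) h2
  simp only [actLeft, mul_zero, zero_add] at h3
  rw [hxy, show -d' * a + a * d' = 0 by ring] at h3
  -- Clear the rest of the first row, then swap the columns with a sign to reach (k, 0, 0, 1, −ab).
  -- With c = 1, a shear moves k by multiples of 4.
  have h4 := hP.right _ 1 0 (-(y * b)) 1 (by norm_num) h3
  simp only [actRight, mul_one, zero_mul, one_mul, add_zero, mul_zero, zero_add, neg_add_cancel] at h4
  have h5 := hP.right _ 0 (-1) 1 0 (by norm_num) h4
  simp only [actRight, mul_one, zero_mul, add_zero, mul_zero] at h5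
  have h6 := fun t => hP.shear _ t h5
  simp only [actShear, mul_one] at h6
  have hk : ∃ t, k - 4 * t = 0 ∨ k - 4 * t = 1 ∨ k - 4 * t = 2 ∨ k - 4 * t = -1 := by
    rcases (by omega : k % 4 = 0 ∨ k % 4 = 1 ∨ k % 4 = 2 ∨ k % 4 = 3) with h | h | h | h
    · exact ⟨k / 4, by omega⟩
    · exact ⟨k / 4, by omega⟩
    · exact ⟨k / 4, by omega⟩
    · exact ⟨k / 4 + 1, by omega⟩
  obtain ⟨t, ht⟩ := hk
  -- The residue −1 becomes 1 by negation; −1 in the left group then restores c = 1.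
  by_cases htn : k - 4 * t = -1
  · have h7 := hP.neg _ (h6 t)
    simp only [actNeg, neg_zero, htn, neg_neg] at h7
    have h8 := hP.left _ (-1) 0 0 (-1) (by norm_num) h7
    simp only [actLeft, mul_zero, zero_mul, add_zero, zero_add, neg_mul, one_mul, neg_neg] at h8
    refine ⟨1, _, by simp, ?_, h8⟩
    simp only [disc]
    have ht' : k = 4 * t - 1 := by omega
    rw [ht']
    ring
  · refine ⟨k - 4 * t, _, by omega, ?_, h6 t⟩
    simp only [disc]
    ring

end SingularVector

/-! ### Symplectic frames -/

namespace PolarizedAbelianSurface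

variable {A B : PolarizedAbelianSurface}

theorem form_neg_swap (A : PolarizedAbelianSurface) (x y : Fin 2 → ℂ) :
    A.form x y = -A.form y x := by
  have h := A.form_self (x + y)
  simp only [map_add, LinearMap.add_apply, A.form_self] at h
  linarith

/-- A symplectic basis of the period lattice. -/
structure SymplecticFrame (A : PolarizedAbelianSurface) where
  e₁ : Fin 2 → ℂ
  e₂ : Fin 2 → ℂ
  f₁ : Fin 2 → ℂ
  f₂ : Fin 2 → ℂ
  span_eq : Submodule.span ℤ {e₁, e₂, f₁, f₂} = A.lattice
  form_e₁_e₂ : A.form e₁ e₂ = 0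
  form_f₁_f₂ : A.form f₁ f₂ = 0
  form_e₁_f₁ : A.form e₁ f₁ = 1
  form_e₂_f₂ : A.form e₂ f₂ = 2
  form_e₁_f₂ : A.form e₁ f₂ = 0
  form_e₂_f₁ : A.form e₂ f₁ = 0

theorem nonempty_symplecticFrame (A : PolarizedAbelianSurface) : Nonempty A.SymplecticFrame := by
  obtain ⟨b, h1, h2, h3⟩ := A.exists_symplectic_basis
  refine ⟨⟨b (.inl 0), b (.inl 1), b (.inr 0), b (.inr 1), ?_, h1 0 1, h2 0 1, ?_, ?_, ?_, ?_⟩⟩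
  · have h := b.span_eq
    have h' := congrArg (Submodule.map A.lattice.subtype) h
    rw [Submodule.map_span, Submodule.map_top, Submodule.range_subtype] at h'
    refine Eq.trans ?_ h'
    congr 1
    ext x
    simp only [Set.mem_insert_iff, Set.mem_singleton_iff, Set.mem_image, Set.mem_range,
      Sum.exists, Fin.exists_fin_two, Submodule.subtype_apply]
    constructor
    · rintro (rfl | rfl | rfl | rfl) <;> exact ⟨_, by tauto, rfl⟩
    · rintro ⟨y, (rfl | rfl) | rfl | rfl, rfl⟩ <;> tauto
  · simpa [polType] using h3 0 0
  · simpa [polType] using h3 1 1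
  · simpa [polType] using h3 0 1
  · simpa [polType] using h3 1 0

namespace SymplecticFrame

/-- The frame of the surface with period matrix `(Z, P)` given by the columns. -/
noncomputable def ofPeriod (τ : siegelSpace) : (periodSurface τ).SymplecticFrame where
  e₁ := periodVector τ (.inl 0)
  e₂ := periodVector τ (.inl 1)
  f₁ := periodVector τ (.inr 0)
  f₂ := periodVector τ (.inr 1)
  span_eq := by
    change _ = Submodule.span ℤ (Set.range (periodBasis τ.2))
    rw [coe_periodBasis]
    congr 1
    ext x
    simp only [Set.mem_insert_iff, Set.mem_singleton_iff, Set.mem_range, Sum.exists,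
      Fin.exists_fin_two]
    tauto
  form_e₁_e₂ := periodForm_inl_inl τ.2 0 1
  form_f₁_f₂ := periodForm_inr_inr τ 0 1
  form_e₁_f₁ := (periodForm_inl_inr τ.2 0 0).trans (by simp [polType])
  form_e₂_f₂ := (periodForm_inl_inr τ.2 1 1).trans (by simp [polType])
  form_e₁_f₂ := (periodForm_inl_inr τ.2 0 1).trans (by simp [polType])
  form_e₂_f₁ := (periodForm_inl_inr τ.2 1 0).trans (by simp [polType])

variable (F : A.SymplecticFrame)

theorem mem_lattice_iff {x : Fin 2 → ℂ} : x ∈ A.lattice ↔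
    ∃ p q r s : ℤ, x = p • F.e₁ + q • F.e₂ + r • F.f₁ + s • F.f₂ := by
  rw [← F.span_eq]
  simp only [Submodule.mem_span_insert, Submodule.mem_span_singleton]
  constructor
  · rintro ⟨p, _, ⟨q, _, ⟨r, _, ⟨s, rfl⟩, rfl⟩, rfl⟩, rfl⟩
    exact ⟨p, q, r, s, by abel⟩
  · rintro ⟨p, q, r, s, rfl⟩
    exact ⟨p, _, ⟨q, _, ⟨r, _, ⟨s, rfl⟩, rfl⟩, rfl⟩, by abel⟩

theorem e₁_mem : F.e₁ ∈ A.lattice := F.mem_lattice_iff.2 ⟨1, 0, 0, 0, by simp⟩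
theorem e₂_mem : F.e₂ ∈ A.lattice := F.mem_lattice_iff.2 ⟨0, 1, 0, 0, by simp⟩
theorem f₁_mem : F.f₁ ∈ A.lattice := F.mem_lattice_iff.2 ⟨0, 0, 1, 0, by simp⟩
theorem f₂_mem : F.f₂ ∈ A.lattice := F.mem_lattice_iff.2 ⟨0, 0, 0, 1, by simp⟩

theorem form_e₂_e₁ : A.form F.e₂ F.e₁ = 0 := by rw [form_neg_swap, F.form_e₁_e₂, neg_zero]
theorem form_f₂_f₁ : A.form F.f₂ F.f₁ = 0 := by rw [form_neg_swap, F.form_f₁_f₂, neg_zero]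
theorem form_f₁_e₁ : A.form F.f₁ F.e₁ = -1 := by rw [form_neg_swap, F.form_e₁_f₁]
theorem form_f₂_e₂ : A.form F.f₂ F.e₂ = -2 := by rw [form_neg_swap, F.form_e₂_f₂]
theorem form_f₂_e₁ : A.form F.f₂ F.e₁ = 0 := by rw [form_neg_swap, F.form_e₁_f₂, neg_zero]
theorem form_f₁_e₂ : A.form F.f₁ F.e₂ = 0 := by rw [form_neg_swap, F.form_e₂_f₁, neg_zero]

/-- The pairings of an integral combination of the frame with the frame. -/
theorem form_combination (p q r s : ℤ) :
    A.form (p • F.e₁ + q • F.e₂ + r • F.f₁ + s • F.f₂) F.e₁ = -r ∧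
    A.form (p • F.e₁ + q • F.e₂ + r • F.f₁ + s • F.f₂) F.e₂ = -2 * s ∧
    A.form (p • F.e₁ + q • F.e₂ + r • F.f₁ + s • F.f₂) F.f₁ = p ∧
    A.form (p • F.e₁ + q • F.e₂ + r • F.f₁ + s • F.f₂) F.f₂ = 2 * q := by
  simp only [map_add, map_zsmul, LinearMap.add_apply, LinearMap.smul_apply, A.form_self,
    F.form_e₁_e₂, F.form_f₁_f₂, F.form_e₁_f₁, F.form_e₂_f₂, F.form_e₁_f₂, F.form_e₂_f₁,
    F.form_e₂_e₁, F.form_f₂_f₁, F.form_f₁_e₁, F.form_f₂_e₂, F.form_f₂_e₁, F.form_f₁_e₂]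
  simp only [zsmul_eq_mul, mul_zero, add_zero, zero_add, mul_one]
  refine ⟨by ring, by ring, trivial, by ring⟩

theorem combination_injective {p q r s p' q' r' s' : ℤ}
    (h : p • F.e₁ + q • F.e₂ + r • F.f₁ + s • F.f₂ =
      p' • F.e₁ + q' • F.e₂ + r' • F.f₁ + s' • F.f₂) : p = p' ∧ q = q' ∧ r = r' ∧ s = s' := by
  obtain ⟨h1, h2, h3, h4⟩ := F.form_combination p q r s
  obtain ⟨k1, k2, k3, k4⟩ := F.form_combination p' q' r' s'
  rw [h] at h1 h2 h3 h4
  rw [h1] at k1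
  rw [h2] at k2
  rw [h3] at k3
  rw [h4] at k4
  norm_num at k1 k2 k3 k4
  exact ⟨k3, k4, k1, k2⟩

/-- The unimodular base change in the first hyperbolic plane. -/
def left (p q r s : ℤ) (h : p * s - q * r = 1) : A.SymplecticFrame where
  e₁ := p • F.e₁ + q • F.f₁
  e₂ := F.e₂
  f₁ := r • F.e₁ + s • F.f₁
  f₂ := F.f₂
  span_eq := by
    apply le_antisymm
    · simp only [Submodule.span_le, Set.insert_subset_iff, Set.singleton_subset_iff, SetLike.mem_coe]
      exact ⟨add_mem (A.lattice.smul_mem _ F.e₁_mem) (A.lattice.smul_mem _ F.f₁_mem), F.e₂_mem,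
        add_mem (A.lattice.smul_mem _ F.e₁_mem) (A.lattice.smul_mem _ F.f₁_mem), F.f₂_mem⟩
    · intro x hx
      obtain ⟨x₁, x₂, x₃, x₄, rfl⟩ := F.mem_lattice_iff.1 hx
      simp only [Submodule.mem_span_insert, Submodule.mem_span_singleton]
      refine ⟨s * x₁ - r * x₃, _, ⟨x₂, _, ⟨p * x₃ - q * x₁, _, ⟨x₄, rfl⟩, rfl⟩, rfl⟩, ?_⟩
      linear_combination (exp := 1) (-h) • (x₁ • F.e₁ + x₃ • F.f₁)
  form_e₁_e₂ := by
    simp only [map_add, map_sub, map_zsmul, LinearMap.add_apply, LinearMap.sub_apply,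
      LinearMap.smul_apply, A.form_self, F.form_e₁_e₂, F.form_f₁_e₂]
    simp
  form_f₁_f₂ := by
    simp only [map_add, map_sub, map_zsmul, LinearMap.add_apply, LinearMap.sub_apply,
      LinearMap.smul_apply, A.form_self, F.form_e₁_f₂, F.form_f₁_f₂]
    simp
  form_e₁_f₁ := by
    simp only [map_add, map_sub, map_zsmul, LinearMap.add_apply, LinearMap.sub_apply,
      LinearMap.smul_apply, A.form_self, F.form_e₁_f₁, F.form_f₁_e₁]
    simp only [zsmul_eq_mul, mul_zero, mul_one, add_zero, zero_add, mul_neg]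
    exact_mod_cast (show -(r * q) + s * p = (1 : ℤ) by linear_combination h)
  form_e₂_f₂ := F.form_e₂_f₂
  form_e₁_f₂ := by
    simp only [map_add, map_sub, map_zsmul, LinearMap.add_apply, LinearMap.sub_apply,
      LinearMap.smul_apply, A.form_self, F.form_e₁_f₂, F.form_f₁_f₂]
    simp
  form_e₂_f₁ := by
    simp only [map_add, map_sub, map_zsmul, LinearMap.add_apply, LinearMap.sub_apply,
      LinearMap.smul_apply, A.form_self, F.form_e₂_e₁, F.form_e₂_f₁]
    simp

/-- The unimodular base change in the second hyperbolic plane. -/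
def right (p q r s : ℤ) (h : p * s - q * r = 1) : A.SymplecticFrame where
  e₁ := F.e₁
  e₂ := p • F.e₂ + q • F.f₂
  f₁ := F.f₁
  f₂ := r • F.e₂ + s • F.f₂
  span_eq := by
    apply le_antisymm
    · simp only [Submodule.span_le, Set.insert_subset_iff, Set.singleton_subset_iff, SetLike.mem_coe]
      exact ⟨F.e₁_mem, add_mem (A.lattice.smul_mem _ F.e₂_mem) (A.lattice.smul_mem _ F.f₂_mem),
        F.f₁_mem, add_mem (A.lattice.smul_mem _ F.e₂_mem) (A.lattice.smul_mem _ F.f₂_mem)⟩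
    · intro x hx
      obtain ⟨x₁, x₂, x₃, x₄, rfl⟩ := F.mem_lattice_iff.1 hx
      simp only [Submodule.mem_span_insert, Submodule.mem_span_singleton]
      refine ⟨x₁, _, ⟨s * x₂ - r * x₄, _, ⟨x₃, _, ⟨p * x₄ - q * x₂, rfl⟩, rfl⟩, rfl⟩, ?_⟩
      linear_combination (exp := 1) (-h) • (x₂ • F.e₂ + x₄ • F.f₂)
  form_e₁_e₂ := by
    simp only [map_add, map_sub, map_zsmul, LinearMap.add_apply, LinearMap.sub_apply,
      LinearMap.smul_apply, A.form_self, F.form_e₁_e₂, F.form_e₁_f₂]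
    simp
  form_f₁_f₂ := by
    simp only [map_add, map_sub, map_zsmul, LinearMap.add_apply, LinearMap.sub_apply,
      LinearMap.smul_apply, A.form_self, F.form_f₁_e₂, F.form_f₁_f₂]
    simp
  form_e₁_f₁ := F.form_e₁_f₁
  form_e₂_f₂ := by
    simp only [map_add, map_sub, map_zsmul, LinearMap.add_apply, LinearMap.sub_apply,
      LinearMap.smul_apply, A.form_self, F.form_e₂_f₂, F.form_f₂_e₂]
    simp only [zsmul_eq_mul, mul_zero, add_zero, zero_add, mul_neg]
    exact_mod_cast (show -(r * (q * 2)) + s * (p * 2) = (2 : ℤ) by linear_combination 2 * h)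
  form_e₁_f₂ := by
    simp only [map_add, map_sub, map_zsmul, LinearMap.add_apply, LinearMap.sub_apply,
      LinearMap.smul_apply, A.form_self, F.form_e₁_f₂, F.form_e₁_e₂]
    simp
  form_e₂_f₁ := by
    simp only [map_add, map_sub, map_zsmul, LinearMap.add_apply, LinearMap.sub_apply,
      LinearMap.smul_apply, A.form_self, F.form_f₂_f₁, F.form_e₂_f₁]
    simp

/-- The base change by a transvection mixing the two hyperbolic planes. -/
def shear (m : ℤ) : A.SymplecticFrame where
  e₁ := F.e₁
  e₂ := F.e₂ + (2 * m) • F.e₁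
  f₁ := F.f₁ - m • F.f₂
  f₂ := F.f₂
  span_eq := by
    apply le_antisymm
    · simp only [Submodule.span_le, Set.insert_subset_iff, Set.singleton_subset_iff, SetLike.mem_coe]
      exact ⟨F.e₁_mem, add_mem F.e₂_mem (A.lattice.smul_mem _ F.e₁_mem),
        sub_mem F.f₁_mem (A.lattice.smul_mem _ F.f₂_mem), F.f₂_mem⟩
    · intro x hx
      obtain ⟨x₁, x₂, x₃, x₄, rfl⟩ := F.mem_lattice_iff.1 hx
      simp only [Submodule.mem_span_insert, Submodule.mem_span_singleton]
      refine ⟨x₁ - 2 * m * x₂, _, ⟨x₂, _, ⟨x₃, _, ⟨x₄ + m * x₃, rfl⟩, rfl⟩, rfl⟩, ?_⟩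
      module
  form_e₁_e₂ := by
    simp only [map_add, map_sub, map_zsmul, LinearMap.add_apply, LinearMap.sub_apply,
      LinearMap.smul_apply, A.form_self, F.form_e₁_e₂]
    simp
  form_f₁_f₂ := by
    simp only [map_add, map_sub, map_zsmul, LinearMap.add_apply, LinearMap.sub_apply,
      LinearMap.smul_apply, A.form_self, F.form_f₁_f₂]
    simp
  form_e₁_f₁ := by
    simp only [map_add, map_sub, map_zsmul, LinearMap.add_apply, LinearMap.sub_apply,
      LinearMap.smul_apply, A.form_self, F.form_e₁_f₁, F.form_e₁_f₂]
    simp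
  form_e₂_f₂ := by
    simp only [map_add, map_sub, map_zsmul, LinearMap.add_apply, LinearMap.sub_apply,
      LinearMap.smul_apply, A.form_self, F.form_e₂_f₂, F.form_e₁_f₂]
    simp
  form_e₁_f₂ := F.form_e₁_f₂
  form_e₂_f₁ := by
    simp only [map_add, map_sub, map_zsmul, LinearMap.add_apply, LinearMap.sub_apply,
      LinearMap.smul_apply, A.form_self, F.form_e₁_f₁, F.form_e₂_f₁, F.form_e₂_f₂, F.form_e₁_f₂]
    simp
    ring

/-- The image of a frame under an isomorphism. -/
def map (φ : (Fin 2 → ℂ) ≃ₗ[ℂ] (Fin 2 → ℂ)) (h₁ : ∀ x, φ x ∈ B.lattice ↔ x ∈ A.lattice)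
    (h₂ : ∀ x y, B.form (φ x) (φ y) = A.form x y) : B.SymplecticFrame where
  e₁ := φ F.e₁
  e₂ := φ F.e₂
  f₁ := φ F.f₁
  f₂ := φ F.f₂
  span_eq := by
    ext y
    obtain ⟨x, rfl⟩ := φ.surjective y
    rw [h₁, F.mem_lattice_iff]
    simp only [Submodule.mem_span_insert, Submodule.mem_span_singleton]
    constructor
    · rintro ⟨p, _, ⟨q, _, ⟨r, _, ⟨s, rfl⟩, rfl⟩, rfl⟩, hx⟩
      refine ⟨p, q, r, s, φ.injective ?_⟩
      simp only [map_add, map_zsmul, hx]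
      abel
    · rintro ⟨p, q, r, s, rfl⟩
      refine ⟨p, _, ⟨q, _, ⟨r, _, ⟨s, rfl⟩, rfl⟩, rfl⟩, ?_⟩
      simp only [map_add, map_zsmul]
      abel
  form_e₁_e₂ := (h₂ _ _).trans F.form_e₁_e₂
  form_f₁_f₂ := (h₂ _ _).trans F.form_f₁_f₂
  form_e₁_f₁ := (h₂ _ _).trans F.form_e₁_f₁
  form_e₂_f₂ := (h₂ _ _).trans F.form_e₂_f₂
  form_e₁_f₂ := (h₂ _ _).trans F.form_e₁_f₂
  form_e₂_f₁ := (h₂ _ _).trans F.form_e₂_f₁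

/-! ### Symmetric endomorphisms in a frame -/

/-- The `ℂ`-linear map `T` is, in the frame `F`, the trace-normalized symmetric endomorphism with
coefficients `v`. -/
structure Represents (T : Module.End ℂ (Fin 2 → ℂ)) (v : SingularVector) : Prop where
  map_e₁ : T F.e₁ = v.k • F.e₁ + v.c • F.e₂ - v.a • F.f₂
  map_f₁ : T F.f₁ = v.k • F.f₁ + v.b • F.e₂ - v.d • F.f₂
  map_e₂ : T F.e₂ = (-2 * v.d) • F.e₁ + (2 * v.a) • F.f₁
  map_f₂ : T F.f₂ = (-2 * v.b) • F.e₁ + (2 * v.c) • F.f₁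

variable {F} {T : Module.End ℂ (Fin 2 → ℂ)} {v : SingularVector}

theorem Represents.left (h : F.Represents T v) {p q r s : ℤ} (hu : p * s - q * r = 1) :
    (F.left p q r s hu).Represents T (v.actLeft p q r s) := by
  constructor <;> simp only [SymplecticFrame.left, SingularVector.actLeft, map_add, map_zsmul,
    h.map_e₁, h.map_f₁, h.map_e₂, h.map_f₂]
  · module
  · module
  · linear_combination (exp := 1) (-hu) • ((-2 * v.d) • F.e₁ + (2 * v.a) • F.f₁)
  · linear_combination (exp := 1) (-hu) • ((-2 * v.b) • F.e₁ + (2 * v.c) • F.f₁)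

theorem Represents.right (h : F.Represents T v) {p q r s : ℤ} (hu : p * s - q * r = 1) :
    (F.right p q r s hu).Represents T (v.actRight p q r s) := by
  constructor <;> simp only [SymplecticFrame.right, SingularVector.actRight, map_add, map_zsmul,
    h.map_e₁, h.map_f₁, h.map_e₂, h.map_f₂]
  · linear_combination (exp := 1) (-hu) • (v.c • F.e₂ - v.a • F.f₂)
  · linear_combination (exp := 1) (-hu) • (v.b • F.e₂ - v.d • F.f₂)
  · module
  · module

theorem Represents.neg (h : F.Represents T v) : F.Represents (-T) v.actNeg := by
  constructor <;> simp only [SingularVector.actNeg, LinearMap.neg_apply,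
    h.map_e₁, h.map_f₁, h.map_e₂, h.map_f₂] <;> module

/-- In the new frame T e₂ has e₂-coefficient 2mc, which the normalization requires to be 0; hence
the subtracted integer. -/
theorem Represents.shear (h : F.Represents T v) (m : ℤ) :
    (F.shear m).Represents (T - (2 * m * v.c) • 1) (v.actShear m) := by
  constructor <;> simp only [SymplecticFrame.shear, SingularVector.actShear, map_add, map_sub,
    map_zsmul, LinearMap.sub_apply, LinearMap.smul_apply, Module.End.one_apply,
    h.map_e₁, h.map_f₁, h.map_e₂, h.map_f₂] <;> module

theorem Represents.map (h : F.Represents T v) {φ : (Fin 2 → ℂ) ≃ₗ[ℂ] (Fin 2 → ℂ)}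
    (h₁ : ∀ x, φ x ∈ B.lattice ↔ x ∈ A.lattice) (h₂ : ∀ x y, B.form (φ x) (φ y) = A.form x y) :
    (F.map φ h₁ h₂).Represents (φ.conj T) v := by
  constructor <;> simp only [SymplecticFrame.map, LinearEquiv.conj_apply,
    LinearMap.comp_apply, LinearEquiv.coe_coe, φ.symm_apply_apply, map_add, map_sub, map_zsmul, h.map_e₁, h.map_f₁, h.map_e₂, h.map_f₂]

/-- Each move is realized on the same surface by a new frame and by ±T plus an integer, so v may be
normalized without changing A. -/
theorem stable_represents (A : PolarizedAbelianSurface) : SingularVector.Stable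
    fun v => ∃ (F : A.SymplecticFrame) (T : Module.End ℂ (Fin 2 → ℂ)), F.Represents T v where
  left := fun _ _ _ _ _ hu ⟨_, _, h⟩ => ⟨_, _, h.left hu⟩
  right := fun _ _ _ _ _ hu ⟨_, _, h⟩ => ⟨_, _, h.right hu⟩
  shear := fun _ m ⟨_, _, h⟩ => ⟨_, _, h.shear m⟩
  neg := fun _ ⟨_, _, h⟩ => ⟨_, _, h.neg⟩

end SymplecticFrame

end PolarizedAbelianSurface

/-! ### Real multiplication in a frame -/

theorem Int.dvd_mul_coe_gcd {n y a b : ℤ} (ha : n ∣ y * a) (hb : n ∣ y * b) :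
    n ∣ y * (Int.gcd a b : ℤ) := by
  rw [Int.gcd_eq_gcd_ab, mul_add, ← mul_assoc, ← mul_assoc]
  exact dvd_add (ha.mul_right _) (hb.mul_right _)

/-- The gcd of the five coefficients is 1, so Bézout combines the five divisibilities. -/
theorem SingularVector.IsPrimitive.dvd_of_dvd_mul {v : SingularVector} (hv : v.IsPrimitive)
    {n y : ℤ} (hk : n ∣ y * v.k) (ha : n ∣ y * v.a) (hb : n ∣ y * v.b) (hc : n ∣ y * v.c)
    (hd : n ∣ y * v.d) : n ∣ y := by
  have h := Int.dvd_mul_coe_gcd hk (Int.dvd_mul_coe_gcd ha (Int.dvd_mul_coe_gcd hb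
    (Int.dvd_mul_coe_gcd hc hd)))
  set g₁ := Int.gcd v.c v.d with hg₁
  set g₂ := Int.gcd v.b g₁ with hg₂
  set g₃ := Int.gcd v.a g₂ with hg₃
  have hg : Int.gcd v.k g₃ = 1 := by
    by_contra hne
    obtain ⟨p, hp, hpg⟩ := Nat.exists_prime_and_dvd hne
    have hpg : (p : ℤ) ∣ (Int.gcd v.k g₃ : ℤ) := by exact_mod_cast hpg
    have h3 := hpg.trans (Int.gcd_dvd_right v.k g₃)
    have h2 := h3.trans (Int.gcd_dvd_right v.a g₂)
    have h1 := h2.trans (Int.gcd_dvd_right v.b g₁)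
    exact hv p (Nat.prime_iff_prime_int.1 hp) (hpg.trans (Int.gcd_dvd_left v.k g₃))
      (h3.trans (Int.gcd_dvd_left v.a g₂)) (h2.trans (Int.gcd_dvd_left v.b g₁))
      (h1.trans (Int.gcd_dvd_left v.c v.d)) (h1.trans (Int.gcd_dvd_right v.c v.d))
  rwa [hg, Nat.cast_one, mul_one] at h

namespace PolarizedAbelianSurface

variable {A : PolarizedAbelianSurface}

namespace SymplecticFrame

variable (F : A.SymplecticFrame)

theorem linearMap_ext {M : Type*} [AddCommGroup M] [Module ℝ M] {S T : (Fin 2 → ℂ) →ₗ[ℝ] M}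
    (h₁ : S F.e₁ = T F.e₁) (h₂ : S F.e₂ = T F.e₂) (h₃ : S F.f₁ = T F.f₁) (h₄ : S F.f₂ = T F.f₂) :
    S = T := by
  apply LinearMap.ext_on A.span_eq_top
  intro x hx
  obtain ⟨p, q, r, s, rfl⟩ := F.mem_lattice_iff.1 hx
  simp only [map_add, map_zsmul, h₁, h₂, h₃, h₄]

theorem end_ext {S T : Module.End ℂ (Fin 2 → ℂ)}
    (h₁ : S F.e₁ = T F.e₁) (h₂ : S F.e₂ = T F.e₂) (h₃ : S F.f₁ = T F.f₁) (h₄ : S F.f₂ = T F.f₂) :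
    S = T := by
  have h := F.linearMap_ext (S := S.restrictScalars ℝ) (T := T.restrictScalars ℝ) h₁ h₂ h₃ h₄
  exact LinearMap.ext fun x => LinearMap.congr_fun h x

variable {F} {T T' : Module.End ℂ (Fin 2 → ℂ)} {v v' : SingularVector}

theorem Represents.mem_endRing (h : F.Represents T v) : T ∈ A.endRing := by
  intro x hx
  obtain ⟨p, q, r, s, rfl⟩ := F.mem_lattice_iff.1 hx
  simp only [map_add, map_zsmul, h.map_e₁, h.map_e₂, h.map_f₁, h.map_f₂]
  rw [F.mem_lattice_iff]
  exact ⟨p * v.k - 2 * q * v.d - 2 * s * v.b, p * v.c + r * v.b,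
    2 * q * v.a + r * v.k + 2 * s * v.c, -p * v.a - r * v.d, by module⟩

/-- The polynomial X² − kX − 2(ab − cd) read off here has discriminant `v.disc`. -/
theorem Represents.mul_self (h : F.Represents T v) :
    T * T = v.k • T + (2 * (v.a * v.b - v.c * v.d)) • 1 := by
  apply F.end_ext <;> simp only [Module.End.mul_apply, LinearMap.add_apply, LinearMap.smul_apply,
    Module.End.one_apply, map_add, map_sub, map_zsmul, h.map_e₁, h.map_e₂, h.map_f₁, h.map_f₂] <;>
    module

theorem Represents.form_symm (h : F.Represents T v) (x y : Fin 2 → ℂ) :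
    A.form (T x) y = A.form x (T y) := by
  have key : A.form.compl₁₂ (T.restrictScalars ℝ) LinearMap.id =
      A.form.compl₁₂ LinearMap.id (T.restrictScalars ℝ) := by
    apply F.linearMap_ext <;> apply F.linearMap_ext <;>
      simp only [LinearMap.compl₁₂_apply, LinearMap.id_apply, LinearMap.coe_restrictScalars,
        map_add, map_sub, map_zsmul, LinearMap.add_apply, LinearMap.sub_apply,
        LinearMap.smul_apply, h.map_e₁, h.map_e₂, h.map_f₁, h.map_f₂, A.form_self,
        F.form_e₁_e₂, F.form_f₁_f₂, F.form_e₁_f₁, F.form_e₂_f₂, F.form_e₁_f₂, F.form_e₂_f₁,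
        F.form_e₂_e₁, F.form_f₂_f₁, F.form_f₁_e₁, F.form_f₂_e₂, F.form_f₂_e₁, F.form_f₁_e₂] <;>
      simp only [zsmul_eq_mul] <;> push_cast <;> ring
  exact LinearMap.congr_fun₂ key x y

/-- Self-adjointness makes (x, y) ↦ E(Sx, y) alternating. This imposes ten linear relations on the
sixteen matrix entries, leaving v and the integer e, the e₂-coefficient of S e₂. -/
theorem exists_represents {S : Module.End ℂ (Fin 2 → ℂ)} (F : A.SymplecticFrame)
    (hS : S ∈ A.endRing) (hsymm : ∀ x y, A.form (S x) y = A.form x (S y)) :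
    ∃ (e : ℤ) (v : SingularVector) (T : Module.End ℂ (Fin 2 → ℂ)),
      F.Represents T v ∧ S = e • 1 + T := by
  obtain ⟨p₁, q₁, r₁, s₁, h₁⟩ := F.mem_lattice_iff.1 (hS _ F.e₁_mem)
  obtain ⟨p₂, q₂, r₂, s₂, h₂⟩ := F.mem_lattice_iff.1 (hS _ F.e₂_mem)
  obtain ⟨p₃, q₃, r₃, s₃, h₃⟩ := F.mem_lattice_iff.1 (hS _ F.f₁_mem)
  obtain ⟨p₄, q₄, r₄, s₄, h₄⟩ := F.mem_lattice_iff.1 (hS _ F.f₂_mem)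
  have hswap : ∀ x y, A.form (S x) y = -A.form (S y) x := fun x y => by
    rw [hsymm, form_neg_swap]
  obtain ⟨a₁, b₁, c₁, d₁⟩ := F.form_combination p₁ q₁ r₁ s₁
  obtain ⟨a₂, b₂, c₂, d₂⟩ := F.form_combination p₂ q₂ r₂ s₂
  obtain ⟨a₃, b₃, c₃, d₃⟩ := F.form_combination p₃ q₃ r₃ s₃
  obtain ⟨a₄, b₄, c₄, d₄⟩ := F.form_combination p₄ q₄ r₄ s₄
  rw [← h₁] at a₁ b₁ c₁ d₁
  rw [← h₂] at a₂ b₂ c₂ d₂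
  rw [← h₃] at a₃ b₃ c₃ d₃
  rw [← h₄] at a₄ b₄ c₄ d₄
  have i₁ : r₁ = 0 := by
    have := hswap F.e₁ F.e₁
    rw [a₁] at this
    exact_mod_cast (by linarith : (r₁ : ℝ) = 0)
  have i₂ : s₂ = 0 := by
    have := hswap F.e₂ F.e₂
    rw [b₂] at this
    exact_mod_cast (by linarith : (s₂ : ℝ) = 0)
  have i₃ : p₃ = 0 := by
    have := hswap F.f₁ F.f₁
    rw [c₃] at this
    exact_mod_cast (by linarith : (p₃ : ℝ) = 0)
  have i₄ : q₄ = 0 := by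
    have := hswap F.f₂ F.f₂
    rw [d₄] at this
    exact_mod_cast (by linarith : (q₄ : ℝ) = 0)
  have i₅ : r₂ = -2 * s₁ := by
    have := hswap F.e₁ F.e₂
    rw [b₁, a₂] at this
    exact_mod_cast (by linarith : (r₂ : ℝ) = -2 * s₁)
  have i₆ : r₃ = p₁ := by
    have := hswap F.e₁ F.f₁
    rw [c₁, a₃] at this
    exact_mod_cast (by linarith : (r₃ : ℝ) = p₁)
  have i₇ : r₄ = 2 * q₁ := by
    have := hswap F.e₁ F.f₂
    rw [d₁, a₄] at this
    exact_mod_cast (by linarith : (r₄ : ℝ) = 2 * q₁)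
  have i₈ : p₂ = 2 * s₃ := by
    have := hswap F.e₂ F.f₁
    rw [c₂, b₃] at this
    exact_mod_cast (by linarith : (p₂ : ℝ) = 2 * s₃)
  have i₉ : s₄ = q₂ := by
    have := hswap F.e₂ F.f₂
    rw [d₂, b₄] at this
    exact_mod_cast (by linarith : (s₄ : ℝ) = q₂)
  have i₁₀ : p₄ = -2 * q₃ := by
    have := hswap F.f₁ F.f₂
    rw [d₃, c₄] at this
    exact_mod_cast (by linarith : (p₄ : ℝ) = -2 * q₃)
  subst i₁ i₂ i₃ i₄ i₅ i₆ i₇ i₈ i₉ i₁₀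
  refine ⟨s₄, ⟨r₃ - s₄, -s₁, q₃, q₁, -s₃⟩, S - s₄ • 1, ?_, by abel⟩
  constructor <;> simp only [LinearMap.sub_apply, LinearMap.smul_apply, Module.End.one_apply,
    h₁, h₂, h₃, h₄] <;> module

/-- T e₂ has no e₂-component, so the integer part is read off at e₂; the images of e₁ and f₁ then
give all the other coefficients. -/
theorem Represents.coefficients_unique (h : F.Represents T v) (h' : F.Represents T' v')
    {x y x' y' : ℤ} (heq : x • 1 + y • T = x' • 1 + y' • T') : x = x' ∧ y * v.k = y' * v'.k ∧
      y * v.a = y' * v'.a ∧ y * v.b = y' * v'.b ∧ y * v.c = y' * v'.c ∧ y * v.d = y' * v'.d := by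
  have g₁ := LinearMap.congr_fun heq F.e₁
  have g₂ := LinearMap.congr_fun heq F.f₁
  have g₃ := LinearMap.congr_fun heq F.e₂
  simp only [LinearMap.add_apply, LinearMap.smul_apply, Module.End.one_apply, h.map_e₁, h.map_e₂,
    h.map_f₁, h'.map_e₁, h'.map_e₂, h'.map_f₁] at g₁ g₂ g₃
  obtain ⟨k₁, k₂, k₃, k₄⟩ := F.combination_injective
    (p := x + y * v.k) (q := y * v.c) (r := 0) (s := -(y * v.a))
    (p' := x' + y' * v'.k) (q' := y' * v'.c) (r' := 0) (s' := -(y' * v'.a))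
    (by linear_combination (exp := 1) g₁)
  obtain ⟨l₁, l₂, l₃, l₄⟩ := F.combination_injective
    (p := 0) (q := y * v.b) (r := x + y * v.k) (s := -(y * v.d))
    (p' := 0) (q' := y' * v'.b) (r' := x' + y' * v'.k) (s' := -(y' * v'.d))
    (by linear_combination (exp := 1) g₂)
  obtain ⟨-, m₂, -, -⟩ := F.combination_injective
    (p := y * (-2 * v.d)) (q := x) (r := y * (2 * v.a)) (s := 0)
    (p' := y' * (-2 * v'.d)) (q' := x') (r' := y' * (2 * v'.a)) (s' := 0)
    (by linear_combination (exp := 1) g₃)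
  exact ⟨m₂, by linarith, by linarith, l₂, k₂, by linarith⟩

end SymplecticFrame

-- Write ρ(ω) = e + T. Comparing quadratic equations gives trace k + 2e = D and then `v.disc` = D;
-- properness gives primitivity, since a prime dividing v would allow T to be divided by it.
open QuadraticAlgebra in
theorem HasRealMultiplication.exists_represents {D : ℤ} (hD : 4 ∣ D - D ^ 2)
    (h : A.HasRealMultiplication D) (F : A.SymplecticFrame) :
    ∃ (v : SingularVector) (T : Module.End ℂ (Fin 2 → ℂ)),
      F.Represents T v ∧ v.IsPrimitive ∧ v.disc = D := by
  obtain ⟨ρ, hinj, hsymm, hproper⟩ := h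
  set w : QuadraticOrder D := ⟨0, 1⟩ with hw
  obtain ⟨e, v, T, hT, hS⟩ := F.exists_represents (ρ w).2 (hsymm w)
  have hsq : w * w = ((D - D ^ 2) / 4 : ℤ) • 1 + D • w := omega_mul_omega_eq_add
  have hsq' := congrArg (fun z => (ρ z : Module.End ℂ (Fin 2 → ℂ))) hsq
  simp only [map_mul, map_add, map_zsmul, map_one, Subring.coe_mul, Subring.coe_add,
    Subring.coe_one, AddSubgroupClass.coe_zsmul, hS] at hsq'
  set a₀ : ℤ := (D - D ^ 2) / 4 with ha₀
  have h4 : 4 * a₀ = D - D ^ 2 := Int.mul_ediv_cancel' hD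
  have hTT := hT.mul_self
  set m : ℤ := 2 * (v.a * v.b - v.c * v.d) with hm
  have hexp : (e • 1 + T) * (e • 1 + T) = (e ^ 2 + m) • 1 + (v.k + 2 * e) • T := by
    rw [mul_add, add_mul, add_mul, hTT]
    simp only [smul_mul_assoc, mul_smul_comm, one_mul, mul_one]
    module
  -- Injectivity of ρ pulls the relation back to the order, where 1 and ω are independent, so both
  -- coefficients vanish.
  have hrel : ((v.k + 2 * e - D) • w - (a₀ + e * (v.k + 2 * e) - e ^ 2 - m) • 1 :
      QuadraticOrder D) = 0 := by
    apply hinj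
    apply Subtype.ext
    simp only [map_sub, map_zsmul, map_one, AddSubgroupClass.coe_sub,
      AddSubgroupClass.coe_zsmul, Subring.coe_one, hS, map_zero, Subring.coe_zero]
    rw [hexp] at hsq'
    rw [← sub_eq_zero.2 hsq']
    module
  generalize hN : a₀ + e * (v.k + 2 * e) - e ^ 2 - m = N at hrel
  have him := congrArg QuadraticAlgebra.im hrel
  have hre := congrArg QuadraticAlgebra.re hrel
  simp [hw] at him hre
  refine ⟨v, T, hT, ?_, ?_⟩
  · intro p hp hk ha hb hc hd
    obtain ⟨k', hk⟩ := hk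
    obtain ⟨a', ha⟩ := ha
    obtain ⟨b', hb⟩ := hb
    obtain ⟨c', hc⟩ := hc
    obtain ⟨d', hd⟩ := hd
    have hp0 : (p : ℂ) ≠ 0 := by exact_mod_cast hp.ne_zero
    have hpsmul : ∀ x : Fin 2 → ℂ, (p : ℂ)⁻¹ • (p • x) = x := fun x => by
      rw [← Int.cast_smul_eq_zsmul ℂ, smul_smul, inv_mul_cancel₀ hp0, one_smul]
    have hT' : F.Represents ((p : ℂ)⁻¹ • T) ⟨k', a', b', c', d'⟩ := by
      constructor <;> simp only [LinearMap.smul_apply, hT.map_e₁, hT.map_f₁, hT.map_e₂, hT.map_f₂,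
        hk, ha, hb, hc, hd]
      · rw [← hpsmul (k' • F.e₁ + c' • F.e₂ - a' • F.f₂)]
        congr 1
        module
      · rw [← hpsmul (k' • F.f₁ + b' • F.e₂ - d' • F.f₂)]
        congr 1
        module
      · rw [← hpsmul ((-2 * d') • F.e₁ + (2 * a') • F.f₁)]
        congr 1
        module
      · rw [← hpsmul ((-2 * b') • F.e₁ + (2 * c') • F.f₁)]
        congr 1
        module
    have hpT : p • ((p : ℂ)⁻¹ • T) = T := by
      rw [← Int.cast_smul_eq_zsmul ℂ, smul_smul, mul_inv_cancel₀ hp0, one_smul]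
    have heq : p • (⟨_, hT'.mem_endRing⟩ : A.endRing) = ρ (w - e • 1) := by
      apply Subtype.ext
      simp only [map_sub, map_zsmul, map_one, AddSubgroupClass.coe_sub,
        AddSubgroupClass.coe_zsmul, Subring.coe_one, hS, hpT]
      abel
    -- Now pc = ω − e, whose ω-coefficient is 1, so p would be a unit.
    obtain ⟨c, hc⟩ := hproper _ p _ hp.ne_zero heq
    rw [← hc, ← map_zsmul] at heq
    have him := congrArg QuadraticAlgebra.im (hinj heq)
    simp [hw] at him
    exact hp.not_isUnit (IsUnit.of_mul_eq_one _ him)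
  · have hk : v.k = D - 2 * e := by linarith
    rw [hre, hk] at hN
    simp only [SingularVector.disc, hk]
    linear_combination -4 * hN + h4

-- Since D ≡ k mod 2, T can be shifted by e = (D − k)/2 to satisfy the equation of ω. For
-- properness, if nS = ρ(z), then S is self-adjoint with some vector v′ and nv′ = (im z)v, so
-- primitivity of v gives n ∣ im z.
open QuadraticAlgebra in
theorem SymplecticFrame.Represents.hasRealMultiplication {D : ℤ} (hD : 4 ∣ D - D ^ 2)
    {F : A.SymplecticFrame} {v : SingularVector} {T : Module.End ℂ (Fin 2 → ℂ)}
    (hT : F.Represents T v) (hv : v.IsPrimitive) (hdisc : v.disc = D) :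
    A.HasRealMultiplication D := by
  set a₀ : ℤ := (D - D ^ 2) / 4 with ha₀
  have h4 : 4 * a₀ = D - D ^ 2 := Int.mul_ediv_cancel' hD
  obtain ⟨e, he⟩ : ∃ e, D = v.k + 2 * e := by
    obtain ⟨t, ht⟩ := Int.even_mul_pred_self v.k
    refine ⟨t + 4 * (v.a * v.b - v.c * v.d), ?_⟩
    rw [← hdisc, SingularVector.disc]
    linear_combination ht
  have hTT := hT.mul_self
  set u : A.endRing := e • 1 + ⟨T, hT.mem_endRing⟩ with hu
  have hu' : (u : Module.End ℂ (Fin 2 → ℂ)) = e • 1 + T := rfl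
  have huu : u * u = a₀ • 1 + D • u := by
    apply Subtype.ext
    simp only [Subring.coe_mul, Subring.coe_add, Subring.coe_one, AddSubgroupClass.coe_zsmul, hu']
    rw [mul_add, add_mul, add_mul, hTT]
    simp only [smul_mul_assoc, mul_smul_comm, one_mul, mul_one]
    have hcoef : a₀ = e ^ 2 + 2 * (v.a * v.b - v.c * v.d) - D * e := by
      rw [SingularVector.disc] at hdisc
      have hk : v.k = D - 2 * e := by linarith
      rw [hk] at hdisc
      linarith [h4, hdisc]
    rw [hcoef, he]
    module
  set ρ : QuadraticOrder D →+* A.endRing := (QuadraticAlgebra.lift ⟨u, huu⟩ :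
    QuadraticOrder D →ₐ[ℤ] A.endRing).toRingHom with hρ
  have hρa : ∀ z, (ρ z : Module.End ℂ (Fin 2 → ℂ)) = (z.re + z.im * e) • 1 + z.im • T := fun z => by
    change ((z.re • 1 + z.im • u : A.endRing) : Module.End ℂ (Fin 2 → ℂ)) = _
    simp only [Subring.coe_add, Subring.coe_one, AddSubgroupClass.coe_zsmul, hu']
    module
  have hsymm : ∀ a x y, A.form ((ρ a : Module.End ℂ (Fin 2 → ℂ)) x) y =
      A.form x ((ρ a : Module.End ℂ (Fin 2 → ℂ)) y) := by
    intro a x y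
    rw [hρa]
    simp only [LinearMap.add_apply, LinearMap.smul_apply, Module.End.one_apply, map_add, map_zsmul,
      hT.form_symm x y]
  refine ⟨ρ, ?_, hsymm, ?_⟩
  · rw [injective_iff_map_eq_zero]
    intro z hz
    have hz' : (z.re + z.im * e) • 1 + z.im • T = (0 : ℤ) • 1 + (0 : ℤ) • T := by
      rw [← hρa, hz]
      simp
    obtain ⟨h₀, h₁, h₂, h₃, h₄, h₅⟩ := hT.coefficients_unique hT hz'
    simp only [zero_mul] at h₁ h₂ h₃ h₄ h₅
    have him : z.im = 0 := by
      by_contra hne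
      apply hv 2 Int.prime_two <;> simp_all
    ext
    · simpa [him] using h₀
    · exact him
  · intro S n z hn heq
    have heq' : n • (S : Module.End ℂ (Fin 2 → ℂ)) = (z.re + z.im * e) • 1 + z.im • T := by
      rw [← hρa, ← heq, AddSubgroupClass.coe_zsmul]
    have hSsymm : ∀ x y, A.form ((S : Module.End ℂ (Fin 2 → ℂ)) x) y =
        A.form x ((S : Module.End ℂ (Fin 2 → ℂ)) y) := by
      intro x y
      have h := hsymm z x y
      rw [← heq, AddSubgroupClass.coe_zsmul] at h
      simp only [LinearMap.smul_apply, map_zsmul] at h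
      exact smul_right_injective ℝ hn h
    obtain ⟨e', v', T', hT', hS⟩ := F.exists_represents S.2 hSsymm
    rw [hS, smul_add, smul_smul] at heq'
    obtain ⟨h₀, h₁, h₂, h₃, h₄, h₅⟩ := hT'.coefficients_unique hT heq'
    obtain ⟨y, hy⟩ : n ∣ z.im := hv.dvd_of_dvd_mul ⟨_, h₁.symm⟩ ⟨_, h₂.symm⟩ ⟨_, h₃.symm⟩
      ⟨_, h₄.symm⟩ ⟨_, h₅.symm⟩
    refine ⟨⟨e' - y * e, y⟩, ?_⟩
    apply Subtype.ext
    apply smul_right_injective _ hn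
    simp only [hρa, hS]
    rw [smul_add, smul_add, smul_smul, smul_smul, smul_smul, ← hy, heq']
    congr 2
    linear_combination h₀

end PolarizedAbelianSurface

/-! ### The singular relation -/

theorem imMatrix_eq (τ : Fin 3 → ℂ) :
    imMatrix τ = !![(τ 0).im, (τ 1).im; (τ 1).im, (τ 2).im] := by
  ext i j
  fin_cases i <;> fin_cases j <;> rfl

theorem dotProduct_mulVec_fin_two (a b c d : ℝ) (x y : Fin 2 → ℝ) :
    x ⬝ᵥ (!![a, b; c, d] *ᵥ y) =
      x 0 * (a * y 0 + b * y 1) + x 1 * (c * y 0 + d * y 1) := by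
  simp [dotProduct, Matrix.mulVec, Fin.sum_univ_two]

theorem mem_siegelSpace_iff (τ : Fin 3 → ℂ) :
    τ ∈ siegelSpace ↔ 0 < (τ 0).im ∧ (τ 1).im ^ 2 < (τ 0).im * (τ 2).im := by
  change (imMatrix τ).PosDef ↔ _
  constructor
  · intro h
    refine ⟨h.diag_pos (i := 0), ?_⟩
    have := h.det_pos
    rw [imMatrix_eq, Matrix.det_fin_two_of] at this
    linarith
  · rintro ⟨h0, h1⟩
    refine Matrix.PosDef.of_dotProduct_mulVec_pos ?_ ?_
    · rw [Matrix.IsHermitian, Matrix.conjTranspose_eq_transpose_of_trivial, imMatrix_transpose]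
    · intro x hx
      rw [imMatrix_eq, star_trivial, dotProduct_mulVec_fin_two]
      have key : (τ 0).im * (x 0 * ((τ 0).im * x 0 + (τ 1).im * x 1) +
          x 1 * ((τ 1).im * x 0 + (τ 2).im * x 1)) = ((τ 0).im * x 0 + (τ 1).im * x 1) ^ 2 +
          ((τ 0).im * (τ 2).im - (τ 1).im ^ 2) * x 1 ^ 2 := by ring
      refine pos_of_mul_pos_right ?_ h0.le
      rw [key]
      by_cases h : x 1 = 0
      · have hx0 : x 0 ≠ 0 := by
          intro h'
          apply hx
          ext i
          fin_cases i
          · exact h'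
          · exact h
        rw [h]
        have := mul_ne_zero h0.ne' hx0
        simp only [mul_zero, add_zero]
        positivity
      · have : 0 < (τ 0).im * (τ 2).im - (τ 1).im ^ 2 := by linarith
        positivity

/-- The left-hand side of the singular relation with coefficients `v`. -/
def singularForm (v : SingularVector) (τ : Fin 3 → ℂ) : ℂ :=
  v.b * (τ 0 * τ 2 - τ 1 ^ 2) - 2 * v.d * τ 0 - v.k * τ 1 - v.c * τ 2 + 2 * v.a

namespace PolarizedAbelianSurface

namespace SymplecticFrame

theorem ofPeriod_e₁ (τ : siegelSpace) : (ofPeriod τ).e₁ = ![τ.1 0, τ.1 1] := by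
  ext i
  fin_cases i <;> rfl

theorem ofPeriod_e₂ (τ : siegelSpace) : (ofPeriod τ).e₂ = ![τ.1 1, τ.1 2] := by
  ext i
  fin_cases i <;> rfl

theorem ofPeriod_f₁ (τ : siegelSpace) : (ofPeriod τ).f₁ = ![1, 0] := by
  ext i
  fin_cases i <;> simp [ofPeriod, periodVector, polType]

theorem ofPeriod_f₂ (τ : siegelSpace) : (ofPeriod τ).f₂ = ![0, 2] := by
  ext i
  fin_cases i <;> simp [ofPeriod, periodVector, polType]

/-- Since f₁, f₂ are a ℂ-basis, T is determined by their prescribed images. Writing e₁ = τ₀f₁ +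
(τ₁/2)f₂, the second coordinate of the condition on T e₁ is the singular relation; in the converse,
the remaining coordinates hold identically or by the same relation. -/
theorem exists_ofPeriod_represents_iff (τ : siegelSpace) (v : SingularVector) :
    (∃ T, (ofPeriod τ).Represents T v) ↔ singularForm v τ = 0 := by
  constructor
  · rintro ⟨T, h⟩
    have he : (ofPeriod τ).e₁ = (τ : Fin 3 → ℂ) 0 • (ofPeriod τ).f₁ +
        ((τ : Fin 3 → ℂ) 1 / 2) • (ofPeriod τ).f₂ := by
      ext i
      fin_cases i <;> simp [ofPeriod_e₁, ofPeriod_f₁, ofPeriod_f₂]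
    have h1 := h.map_e₁
    rw [he, map_add, map_smul, map_smul, h.map_f₁, h.map_f₂, ← he] at h1
    simp only [← Int.cast_smul_eq_zsmul ℂ] at h1
    have h2 := congrFun h1 1
    simp [ofPeriod_e₁, ofPeriod_e₂, ofPeriod_f₁, ofPeriod_f₂] at h2
    rw [singularForm]
    linear_combination h2
  · intro h
    rw [singularForm] at h
    set t : Fin 3 → ℂ := τ.1 with ht
    refine ⟨Matrix.toLin' !![v.k + v.b * t 1, v.c - v.b * t 0; v.b * t 2 - 2 * v.d, -v.b * t 1], ?_⟩
    constructor <;> simp only [← Int.cast_smul_eq_zsmul ℂ] <;> ext i <;> fin_cases i <;>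
      simp [ofPeriod_e₁, ofPeriod_e₂, ofPeriod_f₁, ofPeriod_f₂, Matrix.mulVec, dotProduct,
        Fin.sum_univ_two, ← ht]
    · ring
    · linear_combination h
    · ring
    · linear_combination -h
    · ring
    · ring
    · ring

/-! ### Period matrices of frames -/

variable {A : PolarizedAbelianSurface}

theorem form_smul_I (A : PolarizedAbelianSurface) (x y : Fin 2 → ℂ) :
    A.form x (Complex.I • y) = -A.form (Complex.I • x) y := by
  have h := A.form_I_smul (Complex.I • x) y
  rw [smul_smul, Complex.I_mul_I, neg_one_smul, map_neg, LinearMap.neg_apply] at h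
  linarith

theorem complex_smul_eq (z : ℂ) (x : Fin 2 → ℂ) :
    z • x = z.re • x + z.im • (Complex.I • x) := by
  ext i
  simp only [Pi.smul_apply, Pi.add_apply, smul_eq_mul, Complex.real_smul]
  nth_rewrite 1 [← Complex.re_add_im z]
  ring

/-- The Riemann form in coordinates with respect to two orthogonal vectors. -/
theorem form_smul_add_smul {g₁ g₂ : Fin 2 → ℂ} (h : A.form g₁ g₂ = 0) (x₁ x₂ y₁ y₂ : ℂ) :
    A.form (x₁ • g₁ + x₂ • g₂) (y₁ • g₁ + y₂ • g₂) =
      A.form (Complex.I • g₁) g₁ * (x₁.im * y₁.re - x₁.re * y₁.im) +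
      A.form (Complex.I • g₁) g₂ *
        (x₁.im * y₂.re - x₁.re * y₂.im + x₂.im * y₁.re - x₂.re * y₁.im) +
      A.form (Complex.I • g₂) g₂ * (x₂.im * y₂.re - x₂.re * y₂.im) := by
  have h' : A.form g₂ g₁ = 0 := by rw [form_neg_swap, h, neg_zero]
  have h'' : A.form (Complex.I • g₂) g₁ = A.form (Complex.I • g₁) g₂ := by
    rw [form_neg_swap, form_smul_I, neg_neg]
  simp only [complex_smul_eq x₁, complex_smul_eq x₂, complex_smul_eq y₁, complex_smul_eq y₂,
    map_add, LinearMap.add_apply, map_smul, LinearMap.smul_apply, A.form_I_smul, form_smul_I,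
    A.form_self, h, h', h'', smul_eq_mul]
  ring

/-- Half of the last vector of a frame. -/
noncomputable def h₂ (F : A.SymplecticFrame) : Fin 2 → ℂ := (1 / 2 : ℝ) • F.f₂

variable (F : A.SymplecticFrame)

theorem form_f₁_h₂ : A.form F.f₁ F.h₂ = 0 := by rw [h₂, map_smul, F.form_f₁_f₂, smul_zero]
theorem form_e₁_h₂ : A.form F.e₁ F.h₂ = 0 := by rw [h₂, map_smul, F.form_e₁_f₂, smul_zero]
theorem form_e₂_h₂ : A.form F.e₂ F.h₂ = 1 := by
  rw [h₂, map_smul, F.form_e₂_f₂, smul_eq_mul]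
  norm_num

theorem gram_pos : 0 < A.form (Complex.I • F.f₁) F.f₁ := by
  refine A.form_pos _ fun h => ?_
  have := F.form_e₁_f₁
  rw [h, map_zero] at this
  exact zero_ne_one this

theorem gram_det_pos : A.form (Complex.I • F.f₁) F.h₂ ^ 2 <
    A.form (Complex.I • F.f₁) F.f₁ * A.form (Complex.I • F.h₂) F.h₂ := by
  have hp := F.gram_pos
  set p := A.form (Complex.I • F.f₁) F.f₁ with hpdef
  set q := A.form (Complex.I • F.f₁) F.h₂ with hq
  set r := A.form (Complex.I • F.h₂) F.h₂ with hr
  -- Positivity is applied to the component of h₂ orthogonal to f₁, scaled by p; its norm is p(pr −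
  -- q²). It is nonzero because it pairs with e₂ to p.
  have hne : (-q : ℂ) • F.f₁ + (p : ℂ) • F.h₂ ≠ 0 := by
    intro h
    have h' : (-q) • F.f₁ + p • F.h₂ = 0 := by
      rw [← h]
      ext i
      simp
    have := congrArg (A.form F.e₂) h'
    rw [map_add, map_smul, map_smul, F.form_e₂_f₁, F.form_e₂_h₂, map_zero, smul_eq_mul,
      smul_eq_mul] at this
    linarith
  have h := A.form_pos _ hne
  rw [smul_add, smul_smul, smul_smul, form_smul_add_smul F.form_f₁_h₂] at h
  rw [← hpdef, ← hq, ← hr] at h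
  simp at h
  have h' : 0 < p * (p * r - q ^ 2) := by linarith
  have := pos_of_mul_pos_right h' hp.le
  linarith

/-- Pairing a relation with f₁, h₂ and their multiples by i gives linear systems for the real and
imaginary parts, with the invertible Gram matrix. -/
theorem linearIndependent_lagrangian : LinearIndependent ℂ ![F.f₁, F.h₂] := by
  rw [LinearIndependent.pair_iff]
  intro s t hst
  have hp := F.gram_pos
  have hd := F.gram_det_pos
  have key := fun y₁ y₂ => form_smul_add_smul F.form_f₁_h₂ s t y₁ y₂
  simp only [hst, map_zero, LinearMap.zero_apply] at key
  set p := A.form (Complex.I • F.f₁) F.f₁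
  set q := A.form (Complex.I • F.f₁) F.h₂
  set r := A.form (Complex.I • F.h₂) F.h₂
  have k1 := key 1 0
  have k2 := key 0 1
  have k3 := key Complex.I 0
  have k4 := key 0 Complex.I
  simp at k1 k2 k3 k4
  have hd' : p * r - q ^ 2 ≠ 0 := by linarith
  have s1 : (p * r - q ^ 2) * s.re = 0 := by linear_combination r * k3 - q * k4
  have s2 : (p * r - q ^ 2) * s.im = 0 := by linear_combination (-r) * k1 + q * k2
  have t1 : (p * r - q ^ 2) * t.re = 0 := by linear_combination -q * k3 + p * k4
  have t2 : (p * r - q ^ 2) * t.im = 0 := by linear_combination q * k1 - p * k2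
  exact ⟨Complex.ext ((mul_eq_zero_iff_left hd').1 s1) ((mul_eq_zero_iff_left hd').1 s2),
    Complex.ext ((mul_eq_zero_iff_left hd').1 t1) ((mul_eq_zero_iff_left hd').1 t2)⟩

/-- Every symplectic frame is the frame of columns of a normalized period matrix. -/
theorem exists_period : ∃ (τ : siegelSpace) (φ : (Fin 2 → ℂ) ≃ₗ[ℂ] (Fin 2 → ℂ)),
    (∀ x y, (periodSurface τ).form (φ x) (φ y) = A.form x y) ∧ φ F.e₁ = (ofPeriod τ).e₁ ∧
    φ F.e₂ = (ofPeriod τ).e₂ ∧ φ F.f₁ = (ofPeriod τ).f₁ ∧ φ F.f₂ = (ofPeriod τ).f₂ := by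
  set b : Module.Basis (Fin 2) ℂ (Fin 2 → ℂ) :=
    basisOfLinearIndependentOfCardEqFinrank F.linearIndependent_lagrangian (by simp) with hb
  have hb0 : b 0 = F.f₁ := by simp [hb]
  have hb1 : b 1 = F.h₂ := by simp [hb]
  have hsum : ∀ x, b.equivFun x 0 • F.f₁ + b.equivFun x 1 • F.h₂ = x := fun x => by
    have := b.sum_equivFun x
    rwa [Fin.sum_univ_two, hb0, hb1] at this
  have hp := F.gram_pos
  have hd := F.gram_det_pos
  have key : ∀ x y, A.form x y = _ := fun x y => by
    rw [← hsum x, ← hsum y, form_smul_add_smul F.form_f₁_h₂, hsum x, hsum y]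
  have hφf : b.equivFun F.f₁ = ![1, 0] := by
    ext i
    rw [← hb0, b.equivFun_self]
    fin_cases i <;> simp
  have hφh : b.equivFun F.h₂ = ![0, 1] := by
    ext i
    rw [← hb1, b.equivFun_self]
    fin_cases i <;> simp
  set z := b.equivFun F.e₁ with hz
  set w := b.equivFun F.e₂ with hw
  -- The coordinates of e₁, e₂ in the basis f₁, h₂ are the columns of Z. With G the Gram matrix with
  -- rows (p, q) and (q, r), `k1`–`k4` say G · Im Z = 1, so Im Z is symmetric and positive definite;
  -- `k5` then gives the symmetry of Re Z.
  have k1 := (key F.e₁ F.f₁).symm.trans F.form_e₁_f₁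
  have k2 := (key F.e₁ F.h₂).symm.trans F.form_e₁_h₂
  have k3 := (key F.e₂ F.f₁).symm.trans F.form_e₂_f₁
  have k4 := (key F.e₂ F.h₂).symm.trans F.form_e₂_h₂
  have k5 := (key F.e₁ F.e₂).symm.trans F.form_e₁_e₂
  rw [← hz, ← hw] at k5
  rw [← hz, hφf] at k1
  rw [← hz, hφh] at k2
  rw [← hw, hφf] at k3
  rw [← hw, hφh] at k4
  set p := A.form (Complex.I • F.f₁) F.f₁ with hpdef
  set q := A.form (Complex.I • F.f₁) F.h₂ with hqdef
  set r := A.form (Complex.I • F.h₂) F.h₂ with hrdef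
  simp at k1 k2 k3 k4
  have hd' : p * r - q ^ 2 ≠ 0 := by linarith
  have hz0 : (p * r - q ^ 2) * (z 0).im = r := by linear_combination r * k1 - q * k2
  have hz1 : (p * r - q ^ 2) * (z 1).im = -q := by linear_combination p * k2 - q * k1
  have hw0 : (p * r - q ^ 2) * (w 0).im = -q := by linear_combination r * k3 - q * k4
  have hw1 : (p * r - q ^ 2) * (w 1).im = p := by linear_combination p * k4 - q * k3
  have him : (z 1).im = (w 0).im := mul_left_cancel₀ hd' (hz1.trans hw0.symm)
  have hre : (z 1).re = (w 0).re := by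
    linear_combination (-1 : ℝ) * k5 + (w 0).re * k1 + (w 1).re * k2 - (z 0).re * k3 - (z 1).re * k4
  have hzw : z 1 = w 0 := Complex.ext hre him
  have hr : 0 < r := by nlinarith
  have hdpos : 0 < p * r - q ^ 2 := by linarith
  have hτ : ![z 0, z 1, w 1] ∈ siegelSpace := by
    rw [mem_siegelSpace_iff]
    change 0 < (z 0).im ∧ (z 1).im ^ 2 < (z 0).im * (w 1).im
    refine ⟨pos_of_mul_pos_right (hz0.symm ▸ hr) hdpos.le, ?_⟩
    have h1 : 0 < (p * r - q ^ 2) ^ 2 * ((z 0).im * (w 1).im - (z 1).im ^ 2) := by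
      rw [show (p * r - q ^ 2) ^ 2 * ((z 0).im * (w 1).im - (z 1).im ^ 2) = p * r - q ^ 2 by
        linear_combination (p * r - q ^ 2) * (w 1).im * hz0 + r * hw1
          - ((p * r - q ^ 2) * (z 1).im - q) * hz1]
      exact hdpos
    have := pos_of_mul_pos_right h1 (by positivity)
    linarith
  have hinv : (imMatrix ![z 0, z 1, w 1])⁻¹ = !![p, q; q, r] := by
    apply Matrix.inv_eq_right_inv
    rw [imMatrix_eq]
    ext i j
    fin_cases i <;> fin_cases j <;> simp [Matrix.mul_apply, Fin.sum_univ_two]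
    · linarith
    · linarith
    · linear_combination k3 + p * him
    · linear_combination k4 + q * him
  refine ⟨⟨_, hτ⟩, b.equivFun, ?_, ?_, ?_, ?_, ?_⟩
  · intro x y
    change periodForm _ _ _ = _
    rw [periodForm_apply, hinv, dotProduct_mulVec_fin_two, dotProduct_mulVec_fin_two, key x y]
    simp only [imVec, reVec, LinearMap.compLeft_apply, Function.comp_apply, Complex.imLm_coe,
      Complex.reLm_coe]
    ring
  · rw [ofPeriod_e₁]
    ext i
    fin_cases i <;> simp [hz]
  · rw [ofPeriod_e₂]
    ext i
    fin_cases i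
    · simpa [hw] using hzw.symm
    · simp [hw]
  · rw [ofPeriod_f₁, hφf]
  · rw [ofPeriod_f₂]
    have h2 : F.f₂ = (2 : ℝ) • F.h₂ := by
      rw [h₂, smul_smul]
      norm_num
    have h3 : b.equivFun F.f₂ = (2 : ℂ) • b.equivFun F.h₂ := by
      rw [← map_smul, h2]
      congr 1
    rw [h3, hφh]
    ext i
    fin_cases i <;> simp

/-- Every symplectic frame comes from a point of the Siegel space, compatibly with the
endomorphisms. -/
theorem exists_periodMap_eq : ∃ τ : siegelSpace, periodMap τ = Quotient.mk _ A ∧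
    ∀ v, (∃ T, F.Represents T v) → singularForm v τ = 0 := by
  obtain ⟨τ, φ, hφ, he₁, he₂, hf₁, hf₂⟩ := F.exists_period
  have hlat : ∀ x, φ x ∈ (periodSurface τ).lattice ↔ x ∈ A.lattice := by
    intro x
    rw [F.mem_lattice_iff, (ofPeriod τ).mem_lattice_iff]
    have : ∀ p q r s : ℤ, p • (ofPeriod τ).e₁ + q • (ofPeriod τ).e₂ + r • (ofPeriod τ).f₁ +
        s • (ofPeriod τ).f₂ = φ (p • F.e₁ + q • F.e₂ + r • F.f₁ + s • F.f₂) := by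
      intro p q r s
      simp only [map_add, map_zsmul, he₁, he₂, hf₁, hf₂]
    simp only [this, φ.injective.eq_iff]
  refine ⟨τ, Quotient.sound (Setoid.symm ⟨φ, hlat, hφ⟩), ?_⟩
  rintro v ⟨T, hT⟩
  rw [← exists_ofPeriod_represents_iff]
  have h := hT.map hlat hφ
  refine ⟨φ.conj T, ?_, ?_, ?_, ?_⟩ <;> simp only [← he₁, ← he₂, ← hf₁, ← hf₂]
  exacts [h.map_e₁, h.map_f₁, h.map_e₂, h.map_f₂]

end SymplecticFrame

end PolarizedAbelianSurface

/-! ### The real multiplication locus in the Siegel space -/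

open PolarizedAbelianSurface SymplecticFrame

/-- The surface witnessing membership is only isomorphic to the period surface, so the column frame
is carried to it, v is found there, and T is carried back. -/
theorem mem_realMultiplicationLocus_iff {D : ℤ} (hD : 4 ∣ D - D ^ 2) (τ : siegelSpace) :
    periodMap τ ∈ realMultiplicationLocus D ↔
      ∃ v : SingularVector, v.IsPrimitive ∧ v.disc = D ∧ singularForm v τ = 0 := by
  constructor
  · rintro ⟨A, hA, hRM⟩
    obtain ⟨φ, h₁, h₂⟩ := Quotient.exact hA
    have h₁' : ∀ x, φ.symm x ∈ A.lattice ↔ x ∈ (periodSurface τ).lattice := fun x => by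
      rw [← h₁, φ.apply_symm_apply]
    have h₂' : ∀ x y, A.form (φ.symm x) (φ.symm y) = (periodSurface τ).form x y := fun x y => by
      rw [← h₂, φ.apply_symm_apply, φ.apply_symm_apply]
    obtain ⟨v, T, hT, hv, hdisc⟩ := hRM.exists_represents hD ((ofPeriod τ).map φ.symm h₁' h₂')
    refine ⟨v, hv, hdisc, (exists_ofPeriod_represents_iff τ v).1 ⟨φ.conj T, ?_⟩⟩
    have h := hT.map h₁ h₂
    obtain ⟨h₁, h₂, h₃, h₄⟩ := h
    simp only [SymplecticFrame.map, φ.apply_symm_apply] at h₁ h₂ h₃ h₄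
    exact ⟨h₁, h₂, h₃, h₄⟩
  · rintro ⟨v, hv, hdisc, h⟩
    obtain ⟨T, hT⟩ := (exists_ofPeriod_represents_iff τ v).2 h
    exact ⟨_, rfl, hT.hasRealMultiplication hD hv hdisc⟩

theorem image_preimage_realMultiplicationLocus {D : ℤ} (hD : 4 ∣ D - D ^ 2) :
    Subtype.val '' (periodMap ⁻¹' realMultiplicationLocus D) =
      {τ ∈ siegelSpace | ∃ v : SingularVector, v.IsPrimitive ∧ v.disc = D ∧
        singularForm v τ = 0} := by
  ext τ
  constructor
  · rintro ⟨τ, hτ, rfl⟩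
    exact ⟨τ.2, (mem_realMultiplicationLocus_iff hD τ).1 hτ⟩
  · rintro ⟨hτ, h⟩
    exact ⟨⟨τ, hτ⟩, (mem_realMultiplicationLocus_iff hD ⟨τ, hτ⟩).2 h, rfl⟩

/-! ### Local finiteness of the singular relations and analyticity -/

theorem isOpen_siegelSpace : IsOpen siegelSpace := by
  have : siegelSpace = {τ | 0 < (τ 0).im} ∩ {τ | (τ 1).im ^ 2 < (τ 0).im * (τ 2).im} :=
    Set.ext mem_siegelSpace_iff
  rw [this]
  have hc : ∀ i : Fin 3, Continuous fun τ : Fin 3 → ℂ => (τ i).im := fun i =>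
    Complex.continuous_im.comp (continuous_apply i)
  exact (isOpen_lt continuous_const (hc 0)).inter
    (isOpen_lt ((hc 1).pow 2) ((hc 0).mul (hc 2)))

theorem analyticOnNhd_singularForm (v : SingularVector) (U : Set (Fin 3 → ℂ)) :
    AnalyticOnNhd ℂ (singularForm v) U := by
  intro τ _
  have hc : ∀ i : Fin 3, AnalyticAt ℂ (fun τ : Fin 3 → ℂ => τ i) τ := fun i =>
    (ContinuousLinearMap.proj (R := ℂ) (φ := fun _ : Fin 3 => ℂ) i).analyticAt τ
  unfold singularForm
  exact (((((analyticAt_const.mul (((hc 0).mul (hc 2)).sub ((hc 1).pow 2))).sub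
    (analyticAt_const.mul (hc 0))).sub (analyticAt_const.mul (hc 1))).sub
    (analyticAt_const.mul (hc 2))).add analyticAt_const)

/-- All coefficients are bounded by `C` in absolute value. -/
def SingularVector.BoundedBy (v : SingularVector) (C : ℝ) : Prop :=
  |(v.k : ℝ)| ≤ C ∧ |(v.a : ℝ)| ≤ C ∧ |(v.b : ℝ)| ≤ C ∧ |(v.c : ℝ)| ≤ C ∧ |(v.d : ℝ)| ≤ C

theorem SingularVector.finite_boundedBy (C : ℝ) : {v : SingularVector | v.BoundedBy C}.Finite := by
  have h := (Set.finite_Icc (fun _ : Fin 5 => -⌊C⌋) (fun _ => ⌊C⌋)).image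
    (fun x => (⟨x 0, x 1, x 2, x 3, x 4⟩ : SingularVector))
  refine h.subset ?_
  rintro ⟨k, a, b, c, d⟩ ⟨hk, ha, hb, hc, hd⟩
  have key : ∀ n : ℤ, |(n : ℝ)| ≤ C → -⌊C⌋ ≤ n ∧ n ≤ ⌊C⌋ := by
    intro n hn
    rw [← abs_le, Int.le_floor]
    exact_mod_cast hn
  refine ⟨![k, a, b, c, d], ⟨fun i => ?_, fun i => ?_⟩, rfl⟩
  · fin_cases i
    exacts [(key _ hk).1, (key _ ha).1, (key _ hb).1, (key _ hc).1, (key _ hd).1]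
  · fin_cases i
    exacts [(key _ hk).2, (key _ ha).2, (key _ hb).2, (key _ hc).2, (key _ hd).2]

-- Translating away the real part of τ gives coefficients k′, δ, c′. The imaginary part of the
-- relation is then linear in them, and it turns y₀y₂D into a sum of three nonnegative terms
-- (`hmain`), which bounds b, k′, δ, c′ and then the original coefficients.
set_option maxHeartbeats 1000000 in
theorem SingularVector.boundedBy_of_singularForm_eq_zero (D N : ℝ) (hD : 0 < D) (hN : 1 ≤ N) :
    ∃ C, ∀ (τ : Fin 3 → ℂ) (v : SingularVector), (∀ i, |(τ i).re| ≤ N) → (∀ i, |(τ i).im| ≤ N) →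
      1 ≤ N * (τ 0).im → 1 ≤ N * (τ 2).im → 1 ≤ N * ((τ 0).im * (τ 2).im - (τ 1).im ^ 2) →
      (v.disc : ℝ) = D → singularForm v τ = 0 → v.BoundedBy C := by
  -- R is a bound for √(N⁷D), the worst bound below: N⁵D for the squares of δy₀ and c′y₂, times N²
  -- for removing y₀ and y₂.
  obtain ⟨R, hR0, hRN, hR⟩ : ∃ R : ℝ, 0 ≤ R ∧ 1 ≤ R ∧ N ^ 7 * D ≤ R ^ 2 := by
    refine ⟨N ^ 7 * D + 1, by positivity, le_add_of_nonneg_left (by positivity), ?_⟩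
    have : 0 ≤ N ^ 7 * D := by positivity
    nlinarith
  refine ⟨20 * R * N ^ 2, ?_⟩
  intro τ v hre him h0 h2 hdet hdisc hform
  set x₀ := (τ 0).re with hx₀
  set x₁ := (τ 1).re with hx₁
  set x₂ := (τ 2).re with hx₂
  set y₀ := (τ 0).im with hy₀
  set y₁ := (τ 1).im with hy₁
  set y₂ := (τ 2).im with hy₂
  obtain ⟨k, a, b, c, d⟩ := v
  have eR := congrArg Complex.re hform
  have eI := congrArg Complex.im hform
  simp [singularForm, pow_two, ← hx₀, ← hx₁, ← hx₂, ← hy₀, ← hy₁, ← hy₂] at eR eI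
  simp only [SingularVector.disc] at hdisc
  push_cast at hdisc
  simp only [SingularVector.BoundedBy]
  have bx₀ : |x₀| ≤ N := hre 0
  have bx₁ : |x₁| ≤ N := hre 1
  have bx₂ : |x₂| ≤ N := hre 2
  have by₀ : |y₀| ≤ N := him 0
  have by₁ : |y₁| ≤ N := him 1
  have by₂ : |y₂| ≤ N := him 2
  clear_value x₀ x₁ x₂ y₀ y₁ y₂
  clear hre him hform
  generalize (k : ℝ) = k at *
  generalize (a : ℝ) = a at *
  generalize (b : ℝ) = b at *
  generalize (c : ℝ) = c at *
  generalize (d : ℝ) = d at *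
  have hNpos : 0 < N := by linarith
  have y₀pos : 0 < y₀ := pos_of_mul_pos_right (by linarith) hNpos.le
  have y₂pos : 0 < y₂ := pos_of_mul_pos_right (by linarith) hNpos.le
  set Δ := y₀ * y₂ - y₁ ^ 2 with hΔ
  have Δpos : 0 < Δ := pos_of_mul_pos_right (by linarith) hNpos.le
  set k' := k + 2 * b * x₁ with hk'
  set δ := 2 * d - b * x₂ with hδ
  set c' := c - b * x₀ with hc'
  have hI : δ * y₀ + k' * y₁ + c' * y₂ = 0 := by
    linear_combination -eI
  have hQ : D = k' ^ 2 - 4 * δ * c' + 4 * b ^ 2 * Δ := by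
    linear_combination -hdisc + 4 * b * eR
  have hmain : y₀ * y₂ * D = k' ^ 2 * Δ + (δ * y₀ - c' * y₂) ^ 2 + 4 * b ^ 2 * Δ * (y₀ * y₂) := by
    linear_combination (y₀ * y₂) * hQ - (δ * y₀ + c' * y₂ - k' * y₁) * hI
  have hy : y₀ * y₂ ≤ N * N := mul_le_mul (le_of_abs_le by₀) (le_of_abs_le by₂) y₂pos.le hNpos.le
  have hyD : y₀ * y₂ * D ≤ N ^ 2 * D := by
    rw [pow_two]
    exact mul_le_mul_of_nonneg_right hy hD.le
  have hpow : ∀ i ≤ 7, N ^ i * D ≤ N ^ 7 * D := fun i hi =>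
    mul_le_mul_of_nonneg_right (pow_le_pow_right₀ hN hi) hD.le
  have bk' : k' ^ 2 ≤ N ^ 3 * D := by
    have h1 : k' ^ 2 * 1 ≤ k' ^ 2 * (N * Δ) := mul_le_mul_of_nonneg_left hdet (sq_nonneg _)
    have h3 : k' ^ 2 * Δ ≤ N ^ 2 * D := by
      have : 0 ≤ 4 * b ^ 2 * Δ * (y₀ * y₂) := by positivity
      linarith [sq_nonneg (δ * y₀ - c' * y₂)]
    have := mul_le_mul_of_nonneg_left h3 hNpos.le
    linarith
  have bb : b ^ 2 ≤ N ^ 1 * D := by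
    have h1 : b ^ 2 * 1 ≤ b ^ 2 * (N * Δ) := mul_le_mul_of_nonneg_left hdet (sq_nonneg _)
    have h3 : 4 * b ^ 2 * Δ ≤ D := by
      have : 0 ≤ k' ^ 2 * Δ := by positivity
      have h4 : (y₀ * y₂) * (4 * b ^ 2 * Δ) ≤ (y₀ * y₂) * D := by
        linarith [sq_nonneg (δ * y₀ - c' * y₂)]
      exact le_of_mul_le_mul_left h4 (by positivity)
    have := mul_le_mul_of_nonneg_left h3 hNpos.le
    linarith [mul_nonneg (sq_nonneg b) (mul_nonneg hNpos.le Δpos.le)]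
  have hs : (δ * y₀ - c' * y₂) ^ 2 ≤ N ^ 5 * D := by
    have h1 : 0 ≤ k' ^ 2 * Δ := by positivity
    have h2 : 0 ≤ 4 * b ^ 2 * Δ * (y₀ * y₂) := by positivity
    have h3 : N ^ 2 * D ≤ N ^ 5 * D :=
      mul_le_mul_of_nonneg_right (pow_le_pow_right₀ hN (by norm_num)) hD.le
    linarith
  have ht : (δ * y₀ + c' * y₂) ^ 2 ≤ N ^ 5 * D := by
    rw [show δ * y₀ + c' * y₂ = -(k' * y₁) by linarith, neg_sq, mul_pow]
    have h1 : y₁ ^ 2 ≤ N ^ 2 := sq_le_sq' (neg_le_of_abs_le by₁) (le_of_abs_le by₁)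
    calc k' ^ 2 * y₁ ^ 2 ≤ (N ^ 3 * D) * N ^ 2 :=
          mul_le_mul bk' h1 (sq_nonneg _) (by positivity)
      _ = N ^ 5 * D := by ring
  have hscale : ∀ u y : ℝ, 1 ≤ N * y → (u * y) ^ 2 ≤ N ^ 5 * D → u ^ 2 ≤ N ^ 7 * D := by
    intro u y hy huy
    have h1 : (1 : ℝ) ≤ (N * y) ^ 2 := one_le_pow₀ hy
    calc u ^ 2 = u ^ 2 * 1 := (mul_one _).symm
      _ ≤ u ^ 2 * (N * y) ^ 2 := mul_le_mul_of_nonneg_left h1 (sq_nonneg _)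
      _ = N ^ 2 * (u * y) ^ 2 := by ring
      _ ≤ N ^ 2 * (N ^ 5 * D) := mul_le_mul_of_nonneg_left huy (by positivity)
      _ = N ^ 7 * D := by ring
  have bδ : δ ^ 2 ≤ N ^ 7 * D := hscale δ y₀ h0 (by
    linarith [sq_nonneg (c' * y₂)])
  have bc' : c' ^ 2 ≤ N ^ 7 * D := hscale c' y₂ h2 (by
    linarith [sq_nonneg (δ * y₀)])
  have Rb : |b| ≤ R := abs_le_of_sq_le_sq (bb.trans ((hpow 1 (by norm_num)).trans hR)) hR0
  have Rk : |k'| ≤ R := abs_le_of_sq_le_sq (bk'.trans ((hpow 3 (by norm_num)).trans hR)) hR0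
  have Rδ : |δ| ≤ R := abs_le_of_sq_le_sq (bδ.trans hR) hR0
  have Rc : |c'| ≤ R := abs_le_of_sq_le_sq (bc'.trans hR) hR0
  clear_value k' δ c' Δ
  have hmul : ∀ {u w p q : ℝ}, |u| ≤ p → |w| ≤ q → |u * w| ≤ p * q := by
    intro u w p q hu hw
    rw [abs_mul]
    exact mul_le_mul hu hw (abs_nonneg _) ((abs_nonneg _).trans hu)
  have m1 := hmul Rb bx₁
  have m2 := hmul Rb bx₀
  have m3 := hmul Rb bx₂
  have hRN1 : R ≤ R * N := le_mul_of_one_le_right hR0 hN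
  have hRN2 : R * N ≤ R * N ^ 2 := by
    rw [pow_two, ← mul_assoc]
    exact le_mul_of_one_le_right (by positivity) hN
  have Bk : |k| ≤ 3 * (R * N) := by
    obtain ⟨Rkl, Rkr⟩ := abs_le.1 Rk
    obtain ⟨m1l, m1r⟩ := abs_le.1 m1
    exact abs_le.2 ⟨by linarith only [Rkl, Rkr, m1l, m1r, hk', hRN1],
      by linarith only [Rkl, Rkr, m1l, m1r, hk', hRN1]⟩
  have Bc : |c| ≤ 2 * (R * N) := by
    obtain ⟨Rcl, Rcr⟩ := abs_le.1 Rc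
    obtain ⟨m2l, m2r⟩ := abs_le.1 m2
    exact abs_le.2 ⟨by linarith only [Rcl, Rcr, m2l, m2r, hc', hRN1],
      by linarith only [Rcl, Rcr, m2l, m2r, hc', hRN1]⟩
  have Bd : |d| ≤ R * N := by
    obtain ⟨Rδl, Rδr⟩ := abs_le.1 Rδ
    obtain ⟨m3l, m3r⟩ := abs_le.1 m3
    exact abs_le.2 ⟨by linarith only [Rδl, Rδr, m3l, m3r, hδ, hRN1],
      by linarith only [Rδl, Rδr, m3l, m3r, hδ, hRN1]⟩
  have n1 := hmul Rb (hmul bx₀ bx₂)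
  have n2 := hmul Rb (hmul by₀ by₂)
  have n3 := hmul Rb (hmul bx₁ bx₁)
  have n4 := hmul Rb (hmul by₁ by₁)
  have n5 := hmul Bd bx₀
  have n6 := hmul Bk bx₁
  have n7 := hmul Bc bx₂
  have Ba : |a| ≤ 10 * (R * N ^ 2) := by
    have ha : 2 * a = -(b * (x₀ * x₂)) + b * (y₀ * y₂) + b * (x₁ * x₁) - b * (y₁ * y₁) +
      2 * (d * x₀) + k * x₁ + c * x₂ := by linear_combination eR
    obtain ⟨n1l, n1r⟩ := abs_le.1 n1
    obtain ⟨n2l, n2r⟩ := abs_le.1 n2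
    obtain ⟨n3l, n3r⟩ := abs_le.1 n3
    obtain ⟨n4l, n4r⟩ := abs_le.1 n4
    obtain ⟨n5l, n5r⟩ := abs_le.1 n5
    obtain ⟨n6l, n6r⟩ := abs_le.1 n6
    obtain ⟨n7l, n7r⟩ := abs_le.1 n7
    exact abs_le.2 ⟨by linarith only [n1l, n1r, n2l, n2r, n3l, n3r, n4l, n4r, n5l, n5r, n6l, n6r, n7l, n7r, ha, hRN2],
      by linarith only [n1l, n1r, n2l, n2r, n3l, n3r, n4l, n4r, n5l, n5r, n6l, n6r, n7l, n7r, ha, hRN2]⟩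
  refine ⟨?_, ?_, ?_, ?_, ?_⟩ <;> linarith

theorem exists_nhds_boundedBy {z : Fin 3 → ℂ} (hz : z ∈ siegelSpace) (D : ℝ) (hD : 0 < D) :
    ∃ (U : Set (Fin 3 → ℂ)) (C : ℝ), IsOpen U ∧ z ∈ U ∧ U ⊆ siegelSpace ∧
      ∀ τ ∈ U, ∀ v : SingularVector, (v.disc : ℝ) = D → singularForm v τ = 0 → v.BoundedBy C := by
  obtain ⟨h0, hdet⟩ := (mem_siegelSpace_iff z).1 hz
  have h2 : 0 < (z 2).im := pos_of_mul_pos_right (by nlinarith [sq_nonneg (z 1).im]) h0.le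
  have hd : 0 < (z 0).im * (z 2).im - (z 1).im ^ 2 := by linarith
  obtain ⟨N, hN⟩ : ∃ N : ℝ, 1 ≤ N ∧ (∀ i, |(z i).re| < N) ∧ (∀ i, |(z i).im| < N) ∧
      1 < N * (z 0).im ∧ 1 < N * (z 2).im ∧ 1 < N * ((z 0).im * (z 2).im - (z 1).im ^ 2) := by
    have e1 := Filter.eventually_ge_atTop (1 : ℝ)
    have e2 : ∀ᶠ N : ℝ in Filter.atTop, ∀ i, |(z i).re| < N :=
      Filter.eventually_all.2 fun i => Filter.eventually_gt_atTop _
    have e3 : ∀ᶠ N : ℝ in Filter.atTop, ∀ i, |(z i).im| < N :=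
      Filter.eventually_all.2 fun i => Filter.eventually_gt_atTop _
    have e4 : ∀ y : ℝ, 0 < y → ∀ᶠ N : ℝ in Filter.atTop, 1 < N * y := fun y hy =>
      (Filter.tendsto_id.atTop_mul_const hy).eventually_gt_atTop 1
    exact (e1.and (e2.and (e3.and ((e4 _ h0).and ((e4 _ h2).and (e4 _ hd)))))).exists
  obtain ⟨C, hC⟩ := SingularVector.boundedBy_of_singularForm_eq_zero D N hD hN.1
  have hci : ∀ i : Fin 3, Continuous fun τ : Fin 3 → ℂ => (τ i).im := fun i =>
    Complex.continuous_im.comp (continuous_apply i)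
  have hcr : ∀ i : Fin 3, Continuous fun τ : Fin 3 → ℂ => (τ i).re := fun i =>
    Complex.continuous_re.comp (continuous_apply i)
  refine ⟨siegelSpace ∩ {τ | (∀ i, |(τ i).re| < N) ∧ (∀ i, |(τ i).im| < N) ∧
      1 < N * (τ 0).im ∧ 1 < N * (τ 2).im ∧ 1 < N * ((τ 0).im * (τ 2).im - (τ 1).im ^ 2)}, C,
    isOpen_siegelSpace.inter ?_, ⟨hz, hN.2⟩, Set.inter_subset_left, ?_⟩
  · simp only [Set.ofPred_and, Set.ofPred_forall]
    refine (isOpen_iInter_of_finite fun i => isOpen_lt (hcr i).abs continuous_const).inter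
      ((isOpen_iInter_of_finite fun i => isOpen_lt (hci i).abs continuous_const).inter
      ((isOpen_lt continuous_const (continuous_const.mul (hci 0))).inter
      ((isOpen_lt continuous_const (continuous_const.mul (hci 2))).inter
      (isOpen_lt continuous_const
        (continuous_const.mul (((hci 0).mul (hci 2)).sub ((hci 1).pow 2)))))))
  · rintro τ ⟨-, g1, g2, g3, g4, g5⟩ v hv hτ
    exact hC τ v (fun i => (g1 i).le) (fun i => (g2 i).le) g3.le g4.le g5.le hv hτ

/-- Near a point a single equation suffices: the product of the finitely many relations that can
vanish there. -/
theorem isAnalyticInModuli_realMultiplicationLocus {D : ℤ} (hD : 0 < D) (hD4 : 4 ∣ D - D ^ 2) :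
    IsAnalyticInModuli (realMultiplicationLocus D) := by
  rw [IsAnalyticInModuli, image_preimage_realMultiplicationLocus hD4]
  refine ⟨fun τ h => h.1, fun z hz => ?_⟩
  obtain ⟨U, C, hU, hzU, hUs, hb⟩ := exists_nhds_boundedBy hz D (by exact_mod_cast hD)
  have hfin : {v : SingularVector | v.IsPrimitive ∧ v.disc = D ∧ v.BoundedBy C}.Finite :=
    (SingularVector.finite_boundedBy C).subset fun v hv => hv.2.2
  refine ⟨U, hU, hzU, hUs, 1, fun _ τ => ∏ v ∈ hfin.toFinset, singularForm v τ, fun _ =>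
    Finset.analyticOnNhd_fun_prod _ fun v _ => analyticOnNhd_singularForm v U, ?_⟩
  ext τ
  simp only [Set.mem_inter_iff, Set.mem_ofPred_eq, forall_const, Finset.prod_eq_zero_iff,
    Set.Finite.mem_toFinset]
  constructor
  · rintro ⟨⟨-, v, hv, hdisc, h⟩, hτ⟩
    exact ⟨hτ, v, ⟨hv, hdisc, hb τ hτ v (by exact_mod_cast hdisc) h⟩, h⟩
  · rintro ⟨hτ, v, ⟨hv, hdisc, -⟩, h⟩
    exact ⟨⟨hUs hτ, v, hv, hdisc, h⟩, hτ⟩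

/-! ### Irreducibility -/

open PolarizedAbelianSurface SymplecticFrame

theorem IsAnalyticSubset.exists_disjoint_nhds {Ω A : Set (Fin 3 → ℂ)} (hA : IsAnalyticSubset Ω A)
    {z : Fin 3 → ℂ} (hz : z ∈ Ω) (hzA : z ∉ A) :
    ∃ V : Set (Fin 3 → ℂ), IsOpen V ∧ z ∈ V ∧ Disjoint V A := by
  obtain ⟨U, hU, hzU, -, n, f, hf, hAU⟩ := hA.2 z hz
  obtain ⟨i, hi⟩ : ∃ i, f i z ≠ 0 := by
    by_contra! h
    exact hzA (hAU.symm.subset ⟨hzU, h⟩).1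
  have hcont := (hf i).continuousOn
  refine ⟨U ∩ f i ⁻¹' {0}ᶜ, hcont.isOpen_inter_preimage hU isOpen_compl_singleton, ⟨hzU, hi⟩, ?_⟩
  rw [Set.disjoint_left]
  rintro w ⟨hwU, hw⟩ hwA
  exact hw ((hAU.subset ⟨hwA, hwU⟩).2 i)

/-- Identity theorem: an analytic subset whose preimage in a connected parameter domain has an
interior point contains the image of the whole domain. -/
theorem IsAnalyticSubset.subset_preimage {E : Type*} [NormedAddCommGroup E] [NormedSpace ℂ E]
    {Ω A : Set (Fin 3 → ℂ)} (hA : IsAnalyticSubset Ω A)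
    {W V : Set E} (hW : IsPreconnected W) (hWo : IsOpen W) {ι : E → Fin 3 → ℂ}
    (hι : AnalyticOnNhd ℂ ι W) (hmaps : Set.MapsTo ι W Ω) (hV : IsOpen V) (hVW : V ⊆ W)
    (hVne : V.Nonempty) (hVA : V ⊆ ι ⁻¹' A) : W ⊆ ι ⁻¹' A := by
  let _ : NormedSpace ℝ E := NormedSpace.restrictScalars ℝ ℂ E
  have hsub : W ⊆ interior (ι ⁻¹' A) := by
    apply hW.subset_of_closure_inter_subset isOpen_interior
    · obtain ⟨x, hx⟩ := hVne
      exact ⟨x, hVW hx, mem_interior.2 ⟨V, hVA, hV, hx⟩⟩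
    -- A ball around a limit point w meets the interior; there the pulled-back equations vanish,
    -- hence on the whole ball, and w is interior too.
    · rintro w ⟨hwc, hwW⟩
      obtain ⟨U, hU, hwU, -, n, f, hf, hAU⟩ := hA.2 (ι w) (hmaps hwW)
      have hopen : IsOpen (W ∩ ι ⁻¹' U) := hι.continuousOn.isOpen_inter_preimage hWo hU
      obtain ⟨ε, hε, hball⟩ := Metric.isOpen_iff.1 hopen w ⟨hwW, hwU⟩
      obtain ⟨s, hs, hsB⟩ := mem_closure_iff.1 hwc _ Metric.isOpen_ball (Metric.mem_ball_self hε)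
      have hzero : ∀ i, Set.EqOn (f i ∘ ι) 0 (Metric.ball w ε) := by
        intro i
        refine AnalyticOnNhd.eqOn_zero_of_preconnected_of_eventuallyEq_zero
          ((hf i).comp (hι.mono fun x hx => (hball hx).1) fun x hx => (hball hx).2)
          Metric.isPreconnected_ball hs ?_
        filter_upwards [isOpen_interior.mem_nhds hsB, Metric.isOpen_ball.mem_nhds hs] with x hx hxB
        have hxA : x ∈ ι ⁻¹' A := interior_subset hx
        exact (hAU.subset ⟨hxA, (hball hxB).2⟩).2 i
      refine mem_interior.2 ⟨Metric.ball w ε, fun x hx => ?_, Metric.isOpen_ball,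
        Metric.mem_ball_self hε⟩
      exact (hAU.symm.subset ⟨(hball hx).2, fun i => hzero i hx⟩).1
  exact hsub.trans interior_subset

/-- The parametrization of the hyperplane section `τ₂ = -2 d τ₀ - k τ₁`. -/
noncomputable def sectionMap (k d : ℤ) : (Fin 2 → ℂ) →L[ℂ] (Fin 3 → ℂ) :=
  LinearMap.toContinuousLinearMap
    (Matrix.toLin' !![1, 0; 0, 1; -2 * (d : ℂ), -(k : ℂ)])

theorem sectionMap_apply (k d : ℤ) (w : Fin 2 → ℂ) :
    sectionMap k d w = ![w 0, w 1, -2 * d * w 0 - k * w 1] := by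
  ext i
  fin_cases i <;> simp [sectionMap, Matrix.mulVec, dotProduct, Fin.sum_univ_two]
  ring

theorem singularForm_sectionMap (k d : ℤ) (w : Fin 2 → ℂ) :
    singularForm ⟨k, 0, 0, 1, d⟩ (sectionMap k d w) = 0 := by
  simp [sectionMap_apply, singularForm]

theorem eq_sectionMap_of_singularForm_eq_zero {k d : ℤ} {τ : Fin 3 → ℂ}
    (h : singularForm ⟨k, 0, 0, 1, d⟩ τ = 0) : sectionMap k d ![τ 0, τ 1] = τ := by
  simp [singularForm] at h
  ext i
  fin_cases i <;> simp [sectionMap_apply]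
  linear_combination h

theorem convex_siegelSpace : Convex ℝ siegelSpace := by
  intro x hx y hy a b ha hb hab
  change (imMatrix _).PosDef
  have h : imMatrix (a • x + b • y) = a • imMatrix x + b • imMatrix y := by
    rw [imMatrix_eq, imMatrix_eq, imMatrix_eq]
    ext i j
    fin_cases i <;> fin_cases j <;> simp
  rw [h]
  rcases ha.eq_or_lt with rfl | ha
  · rw [zero_add] at hab
    rw [hab, zero_smul, one_smul, zero_add]
    exact hy
  rcases hb.eq_or_lt with rfl | hb
  · rw [add_zero] at hab
    rw [hab, zero_smul, one_smul, add_zero]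
    exact hx
  exact (Matrix.PosDef.smul hx ha).add (Matrix.PosDef.smul hy hb)

theorem isPreconnected_preimage_sectionMap (k d : ℤ) :
    IsPreconnected (sectionMap k d ⁻¹' siegelSpace) :=
  (convex_siegelSpace.is_linear_preimage
    ((sectionMap k d).restrictScalars ℝ).toLinearMap.isLinear).isPreconnected

theorem nonempty_preimage_sectionMap {k d : ℤ} (h : 0 < k ^ 2 - 8 * d) :
    (sectionMap k d ⁻¹' siegelSpace).Nonempty := by
  -- Here τ₂ = (k² − 4d)i, so det Im Z = 2(k² − 4d) − k² = k² − 8d.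
  refine ⟨![2 * Complex.I, -k * Complex.I], ?_⟩
  rw [Set.mem_preimage, mem_siegelSpace_iff, sectionMap_apply]
  have h' : (0 : ℝ) < k ^ 2 - 8 * d := by exact_mod_cast h
  simp
  nlinarith

theorem isPrimitive_normal_form (k d : ℤ) : (⟨k, 0, 0, 1, d⟩ : SingularVector).IsPrimitive :=
  fun _ hp _ _ _ h _ => hp.not_isUnit (isUnit_of_dvd_one h)

theorem exists_sectionMap_mem {k d : ℤ} (hk : k = 0 ∨ k = 1 ∨ k = 2)
    (hpos : 0 < k ^ 2 - 8 * d) (hsq : ¬ IsSquare (k ^ 2 - 8 * d))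
    (hD4 : 4 ∣ (k ^ 2 - 8 * d) - (k ^ 2 - 8 * d) ^ 2) {m : ModuliSpace}
    (hm : m ∈ realMultiplicationLocus (k ^ 2 - 8 * d)) :
    ∃ (τ : siegelSpace) (w : Fin 2 → ℂ), sectionMap k d w = τ ∧ periodMap τ = m := by
  obtain ⟨A, rfl, hA⟩ := hm
  obtain ⟨F⟩ := A.nonempty_symplecticFrame
  obtain ⟨v, T, hT, hv, hdisc⟩ := hA.exists_represents hD4 F
  obtain ⟨k', d', hk', heq, F', hF'⟩ := (stable_represents A).exists_normal_form ⟨F, T, hT⟩ hv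
    (by rwa [hdisc])
  rw [hdisc] at heq
  -- The squares 0, 1, 4 are distinct modulo 8.
  have hkk : k' = k := by
    rcases hk with rfl | rfl | rfl <;> rcases hk' with rfl | rfl | rfl <;> omega
  subst hkk
  have hdd : d' = d := by linarith
  subst hdd
  obtain ⟨τ, hτ, hsing⟩ := F'.exists_periodMap_eq
  exact ⟨τ, _, eq_sectionMap_of_singularForm_eq_zero (hsing _ hF'), hτ⟩

theorem isIrreducibleInModuli_realMultiplicationLocus {k d : ℤ} (hk : k = 0 ∨ k = 1 ∨ k = 2)
    (hpos : 0 < k ^ 2 - 8 * d) (hsq : ¬ IsSquare (k ^ 2 - 8 * d))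
    (hD4 : 4 ∣ (k ^ 2 - 8 * d) - (k ^ 2 - 8 * d) ^ 2) :
    IsIrreducibleInModuli (realMultiplicationLocus (k ^ 2 - 8 * d)) := by
  set D := k ^ 2 - 8 * d with hD
  set W := sectionMap k d ⁻¹' siegelSpace with hW
  have hWo : IsOpen W := isOpen_siegelSpace.preimage (sectionMap k d).continuous
  have hWc : IsPreconnected W := isPreconnected_preimage_sectionMap k d
  have hmem : ∀ w (hw : w ∈ W), periodMap ⟨sectionMap k d w, hw⟩ ∈ realMultiplicationLocus D :=
    fun w hw => (mem_realMultiplicationLocus_iff hD4 _).2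
      ⟨⟨k, 0, 0, 1, d⟩, isPrimitive_normal_form k d, by simp [SingularVector.disc, hD]; ring,
        singularForm_sectionMap k d w⟩
  -- The slice surjects onto the locus, so containment in S need only be tested on W.
  have hcover : ∀ S : Set ModuliSpace,
      W ⊆ sectionMap k d ⁻¹' (Subtype.val '' (periodMap ⁻¹' S)) →
      realMultiplicationLocus D ⊆ S := by
    intro S hS m hm
    obtain ⟨τ, w, hw, rfl⟩ := exists_sectionMap_mem hk hpos hsq hD4 hm
    have hwW : w ∈ W := by
      rw [hW, Set.mem_preimage, hw]
      exact τ.2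
    obtain ⟨τ', hτ', h⟩ := hS hwW
    rw [hw] at h
    rwa [← Subtype.ext h]
  obtain ⟨w₀, hw₀⟩ := nonempty_preimage_sectionMap hpos
  refine ⟨⟨_, hmem w₀ hw₀⟩, isAnalyticInModuli_realMultiplicationLocus hpos hD4, ?_⟩
  intro A B hA hB hAB
  by_cases h : W ⊆ sectionMap k d ⁻¹' (Subtype.val '' (periodMap ⁻¹' A))
  · exact Or.inl (hcover A h)
  · right
    apply hcover B
    obtain ⟨w, hw, hwA⟩ := Set.not_subset.1 h
    -- If A misses a point of the slice, it misses a neighbourhood, which must lie in B; the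
    -- identity theorem extends this to all of W.
    obtain ⟨V, hV, hwV, hdisj⟩ := hA.exists_disjoint_nhds hw hwA
    refine IsAnalyticSubset.subset_preimage hB hWc hWo
      (fun x _ => (sectionMap k d).analyticAt x) (fun x hx => hx)
      (hWo.inter (hV.preimage (sectionMap k d).continuous)) Set.inter_subset_left ⟨w, hw, hwV⟩ ?_
    rintro x ⟨hxW, hxV⟩
    rcases hAB (hmem x hxW) with hx | hx
    · exact absurd ⟨_, hx, rfl⟩ (Set.disjoint_left.1 hdisj hxV)
    · exact ⟨_, hx, rfl⟩

/-- The locus of `(1,2)`-polarized abelian surfaces with real multiplication by the real quadratic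
order of discriminant `D` is empty for `D ≡ 5 mod 8`, and non-empty and irreducible for
`D ≡ 0, 4 mod 8` and for `D ≡ 1 mod 8`. -/
theorem mainTheorem9 (D : ℤ) (hD : 0 < D) (hsq : ¬ IsSquare D) :
    (D ≡ 5 [ZMOD 8] → realMultiplicationLocus D = ∅) ∧
    (D ≡ 0 [ZMOD 8] ∨ D ≡ 4 [ZMOD 8] →
      (realMultiplicationLocus D).Nonempty ∧ IsIrreducibleInModuli (realMultiplicationLocus D)) ∧
    (D ≡ 1 [ZMOD 8] →
      (realMultiplicationLocus D).Nonempty ∧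
        IsIrreducibleInModuli (realMultiplicationLocus D)) := by
  have hD4 : (D % 4 = 0 ∨ D % 4 = 1) → 4 ∣ D - D ^ 2 := by
    rintro (h | h)
    · obtain ⟨t, rfl⟩ := Int.dvd_of_emod_eq_zero h
      exact ⟨t - 4 * t ^ 2, by ring⟩
    · obtain ⟨t, rfl⟩ : ∃ t, D = 4 * t + 1 := ⟨D / 4, by omega⟩
      exact ⟨-t - 4 * t ^ 2, by ring⟩
  have key : ∀ k : ℤ, (k = 0 ∨ k = 1 ∨ k = 2) → D ≡ k ^ 2 [ZMOD 8] →
      IsIrreducibleInModuli (realMultiplicationLocus D) := by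
    intro k hk hmod
    obtain ⟨d, hd⟩ := hmod.dvd
    obtain rfl : D = k ^ 2 - 8 * d := by linarith
    refine isIrreducibleInModuli_realMultiplicationLocus hk hD hsq (hD4 ?_)
    rcases hk with rfl | rfl | rfl <;> omega
  refine ⟨fun h => ?_, fun h => ?_, fun h => ?_⟩
  · rw [Set.eq_empty_iff_forall_notMem]
    rintro _ ⟨A, rfl, hA⟩
    obtain ⟨F⟩ := A.nonempty_symplecticFrame
    have h5 : D % 8 = 5 := h
    obtain ⟨v, T, -, -, hdisc⟩ := hA.exists_represents (hD4 (Or.inr (by omega))) F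
    rw [SingularVector.disc] at hdisc
    generalize v.a * v.b - v.c * v.d = t at hdisc
    -- D ≡ k² mod 8, and 5 is not a square modulo 8.
    obtain ⟨s, hs | hs⟩ : ∃ s, v.k = 2 * s ∨ v.k = 2 * s + 1 := ⟨v.k / 2, by omega⟩
    · have : D = 4 * s ^ 2 + 8 * t := by rw [← hdisc, hs]; ring
      omega
    · obtain ⟨r, hr⟩ := Int.even_mul_succ_self s
      have : D = 8 * r + 1 + 8 * t := by rw [← hdisc, hs]; linear_combination 4 * hr
      omega
  · have hirr : IsIrreducibleInModuli (realMultiplicationLocus D) := by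
      rcases h with h | h
      · exact key 0 (by simp) (by simpa using h)
      · exact key 2 (by simp) (by simpa using h)
    exact ⟨hirr.1, hirr⟩
  · have hirr := key 1 (by simp) (by simpa using h)
    exact ⟨hirr.1, hirr⟩
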